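/- Let $\mathfrak g$ be a real Lie algebra with basis $e_1,e_2,e_3$, and write $e_{ij}=e_i\wedge e_j$, $e_{123}=e_1\wedge e_2\wedge e_3$, $r=x\,e_{12}+y\,e_{13}+z\,e_{23}\in\Lambda^2\mathfrak g$. Let $[\cdot,\cdot]_S$ be the algebraic Schouten bracket on $\Lambda\mathfrak g$, $$[X_1\wedge\dots\wedge X_s,Y_1\wedge\dots\wedge Y_l]_S=\sum_{i,j}(-1)^{i+j}[X_i,Y_j]\wedge X_1\wedge\dots\widehat{X_i}\dots\wedge X_s\wedge Y_1\wedge\dots\widehat{Y_j}\dots\wedge Y_l ,$$ and $(\Lambda^m\mathfrak g)^{\mathfrak g}=\{w\in\Lambda^m\mathfrak g: [v,w]_S=0\ \forall v\in\mathfrak g\}$. A cocommutator is a linear map $\delta:\mathfrak g\to\Lambda^2\mathfrak g$ whose transpose is a Lie bracket on $\mathfrak g^*$ and which satisfies $\delta([u,v])=[u,\delta(v)]_S+[\delta(u),v]_S$; it is coboundary if $\delta=\delta_r:=[\cdot,r]_S$ for some $r\in\Lambda^2\mathfrak g$, and $r$ is an $r$-matrix if $\delta_r$ is a cocommutator. The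 mCYBE is the condition $[r,r]_S\in(\Lambda^3\mathfrak g)^{\mathfrak g}$. Cocommutators $\delta,\delta'$ are equivalent if $(\Lambda^2T)\circ\delta=\delta'\circ T$ for some $T\in\mathrm{Aut}(\mathfrak g)$. Consider the following nine (families of) commutation relations, given by $([e_1,e_2],[e_1,e_3],[e_3,e_2])$: $\mathfrak{sl}_2:(e_2,-e_3,-e_1)$; $\mathfrak{su}_2:(e_3,-e_2,-e_1)$; $\mathfrak h:(e_3,0,0)$; $\mathfrak r'_{3,0}:(-e_3,e_2,0)$; $\mathfrak r_{3,-1}:(e_2,-e_3,0)$; $\mathfrak r_{3,1}:(e_2,e_3,0)$; $\mathfrak r_3:(0,-e_1,e_1+e_2)$; $\mathfrak r_{3,\lambda}$, $\lambda\in(-1,1)$: $(0,-e_1,\lambda e_2)$; $\mathfrak r'_{3,\lambda}$, $\lambda\neq0$: $(0,\,e_2-\lambda e_1,\,\lambda e_2+e_1)$. Each of them defines a Lie algebra, and every non-abelian real three-dimensional Lie algebra has a basis that satisfies one of them. For a Lie algebra with such a basis the following holds. 1. $(\Lambda^2\mathfrak g)^{\mathfrak g}$ is $\langle e_{13},e_{23}\rangle$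 for $\mathfrak h$, $\langle e_{23}\rangle$ for $\mathfrak r'_{3,0}$ and $\mathfrak r_{3,-1}$, and $0$ in all other cases. $(\Lambda^3\mathfrak g)^{\mathfrak g}$ is $\Lambda^3\mathfrak g$ for $\mathfrak{sl}_2,\mathfrak{su}_2,\mathfrak h,\mathfrak r'_{3,0},\mathfrak r_{3,-1}$ and $0$ for $\mathfrak r_{3,1},\mathfrak r_3,\mathfrak r_{3,\lambda},\mathfrak r'_{3,\lambda}$. 2. $[r,r]_S=c\,e_{123}$ with $c=2z^2-4xy$ for $\mathfrak{sl}_2$; $2(x^2+y^2+z^2)$ for $\mathfrak{su}_2$; $2x^2$ for $\mathfrak h$; $-2(x^2+y^2)$ for $\mathfrak r'_{3,0}$; $-4xy$ for $\mathfrak r_{3,-1}$; $0$ for $\mathfrak r_{3,1}$; $-2z^2$ for $\mathfrak r_3$; $2(\lambda-1)yz$ for $\mathfrak r_{3,\lambda}$; $-2(y^2+z^2)$ for $\mathfrak r'_{3,\lambda}$. 3. The solution set of the mCYBE, which is also the set of $r$-matrices, is $\{z=0\}$ for $\mathfrak r_3$, $\{y=0\}\cup\{z=0\}$ for $\mathfrak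 r_{3,\lambda}$, $\{y=z=0\}$ for $\mathfrak r'_{3,\lambda}$ and $\Lambda^2\mathfrak g$ in all other cases. 4. For $r$-matrices $r,r'$, the cocommutators $\delta_r,\delta_{r'}$ are equivalent if and only if the classes of $r$ and $r'$ in $\Lambda^2\mathfrak g/(\Lambda^2\mathfrak g)^{\mathfrak g}$ lie in the same orbit of $\mathrm{Aut}(\mathfrak g)$. The sets of $r$-matrices that induce equivalent nonzero cocommutators are exactly: - $\mathfrak{sl}_2$: $\{2xy-z^2=k\}$ for each $k\neq0$, and $\{2xy-z^2=0,\ x^2+y^2\ne0\}$; - $\mathfrak{su}_2$: $\{x^2+y^2+z^2=k\}$ for each $k>0$; - $\mathfrak h$: $\{x\ne0\}$; - $\mathfrak r'_{3,0}$: $\{x^2+y^2>0\}$; - $\mathfrak r_{3,-1}$: $\{xy=0,\ x^2+y^2\neq0\}$ and $\{xy\ne0\}$; - $\mathfrak r_{3,1}$: $\{x^2+y^2\ne0\}$ and $\{x=y=0,\ z\neq0\}$; - $\mathfrak r_3$: $\{x>0,y=z=0\}$, $\{x<0,y=z=0\}$ and $\{y\neq0,z=0\}$; - $\mathfrak r_{3,\lambda}$: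 $\{y=0,z\ne0\}$, $\{z=0,y\neq0\}$ and $\{y=z=0,x\ne0\}$; - $\mathfrak r'_{3,\lambda}$: $\{x>0,y=z=0\}$ and $\{x<0,y=z=0\}$. 5. Every nonzero coboundary cocommutator is equivalent to $\delta_r$ for exactly one $r$ in the following list, and every $r$ in the list is an $r$-matrix with $\delta_r\neq0$: - $\mathfrak{sl}_2$: $a\,e_{23}$ $(a>0)$, $a(e_{12}+e_{13})$ $(a>0)$, $e_{12}$; - $\mathfrak{su}_2$: $a\,e_{12}$ $(a>0)$; - $\mathfrak h$: $e_{12}$; $\ \mathfrak r'_{3,0}$: $e_{12}$; - $\mathfrak r_{3,-1}$: $e_{12}$, $e_{12}-e_{13}$; - $\mathfrak r_{3,1}$: $e_{13}$, $e_{23}$; - $\mathfrak r_3$: $e_{12}$, $-e_{12}$, $e_{13}$; - $\mathfrak r_{3,\lambda}$: $e_{12}$, $e_{23}$, $e_{13}$; - $\mathfrak r'_{3,\lambda}$: $e_{12}$, $-e_{12}$. -/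

import Mathlib

open Module

noncomputable section

namespace CoboundaryLie

section Schouten

variable {L : Type*} [LieRing L] [LieAlgebra ℝ L] {κ : Type*} [Fintype κ]

/-- Contraction of a multivector with a covector,
`ι_θ (X₁ ∧ ⋯ ∧ Xₙ) = ∑ᵢ (-1)^(i+1) θ(Xᵢ) X₁ ∧ ⋯ X̂ᵢ ⋯ ∧ Xₙ`. -/
def contract (θ : Dual ℝ L) : ExteriorAlgebra ℝ L →ₗ[ℝ] ExteriorAlgebra ℝ L :=
  CliffordAlgebra.contractLeft (Q := (0 : QuadraticForm ℝ L)) θ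

theorem contract_ι_mul (θ : Dual ℝ L) (v : L) (w : ExteriorAlgebra ℝ L) :
    contract θ (ExteriorAlgebra.ι ℝ v * w) =
      θ v • w - ExteriorAlgebra.ι ℝ v * contract θ w :=
  CliffordAlgebra.contractLeft_ι_mul (Q := (0 : QuadraticForm ℝ L)) θ v w

theorem contract_ιMulti (θ : Dual ℝ L) : ∀ (n : ℕ) (X : Fin (n + 1) → L),
    contract θ (ExteriorAlgebra.ιMulti ℝ (n + 1) X) =
      ∑ i : Fin (n + 1), ((-1 : ℝ) ^ (i : ℕ) * θ (X i)) •
        ExteriorAlgebra.ιMulti ℝ n (fun k => X (i.succAbove k))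
  | 0, X => by
      have h1 : contract θ (1 : ExteriorAlgebra ℝ L) = 0 :=
        CliffordAlgebra.contractLeft_one (Q := (0 : QuadraticForm ℝ L)) θ
      have h2 := contract_ι_mul θ (X 0) 1
      rw [mul_one, h1, mul_zero, sub_zero] at h2
      simp [ExteriorAlgebra.ιMulti_succ_apply, h2]
  | n + 1, X => by
      rw [ExteriorAlgebra.ιMulti_succ_apply, contract_ι_mul, contract_ιMulti θ n,
        Fin.sum_univ_succ (n := n + 1), Finset.mul_sum, sub_eq_add_neg, ← Finset.sum_neg_distrib]
      congr 1
      · simp [Matrix.vecTail, Function.comp_def]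
      · refine Finset.sum_congr rfl fun i _ => ?_
        rw [ExteriorAlgebra.ιMulti_succ_apply, mul_smul_comm, ← neg_smul]
        simp [Matrix.vecTail, Function.comp_def, pow_succ]

theorem contract_mem (θ : Dual ℝ L) (n : ℕ) {w : ExteriorAlgebra ℝ L}
    (hw : w ∈ ⋀[ℝ]^(n + 1) L) : contract θ w ∈ ⋀[ℝ]^n L := by
  rw [← ExteriorAlgebra.ιMulti_span_fixedDegree] at hw
  induction hw using Submodule.span_induction with
  | mem x hx =>
      obtain ⟨X, rfl⟩ := hx
      rw [contract_ιMulti]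
      exact Submodule.sum_mem _ fun i _ => Submodule.smul_mem _ _
        (ExteriorAlgebra.ιMulti_range ℝ n ⟨_, rfl⟩)
  | zero => simp
  | add x y _ _ hx hy => rw [map_add]; exact Submodule.add_mem _ hx hy
  | smul c x _ hx => rw [map_smul]; exact Submodule.smul_mem _ _ hx

/-- The value of the algebraic Schouten bracket, written with a basis `e` of the Lie algebra and
the dual basis `e*`: `[X, Y] = ∑ᵢⱼ [eᵢ, eⱼ] ∧ ι_{e*ᵢ} X ∧ ι_{e*ⱼ} Y`. By `schouten_ιMulti` it is
the usual bracket, so it does not depend on the basis. -/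
def schoutenVal (e : Basis κ ℝ L) (X Y : ExteriorAlgebra ℝ L) : ExteriorAlgebra ℝ L :=
  ∑ i, ∑ j, ExteriorAlgebra.ι ℝ ⁅e i, e j⁆ * contract (e.coord i) X * contract (e.coord j) Y

theorem schoutenVal_mem (e : Basis κ ℝ L) (p q : ℕ) {X Y : ExteriorAlgebra ℝ L}
    (hX : X ∈ ⋀[ℝ]^(p + 1) L) (hY : Y ∈ ⋀[ℝ]^(q + 1) L) :
    schoutenVal e X Y ∈ ⋀[ℝ]^(p + q + 1) L := by
  refine Submodule.sum_mem _ fun i _ => Submodule.sum_mem _ fun j _ => ?_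
  have h1 : ExteriorAlgebra.ι ℝ ⁅e i, e j⁆ ∈ ⋀[ℝ]^1 L := by
    simp [ExteriorAlgebra.exteriorPower]
  have h := SetLike.mul_mem_graded (SetLike.mul_mem_graded h1 (contract_mem (e.coord i) p hX))
    (contract_mem (e.coord j) q hY)
  have hd : 1 + p + q = p + q + 1 := by omega
  rwa [hd] at h

/-- The algebraic Schouten bracket `Λ^(p+1) g × Λ^(q+1) g → Λ^(p+q+1) g`. -/
def schouten (e : Basis κ ℝ L) (p q : ℕ) :
    ⋀[ℝ]^(p + 1) L →ₗ[ℝ] ⋀[ℝ]^(q + 1) L →ₗ[ℝ] ⋀[ℝ]^(p + q + 1) L :=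
  LinearMap.mk₂ ℝ (fun X Y => ⟨schoutenVal e X Y, schoutenVal_mem e p q X.2 Y.2⟩)
    (fun X X' Y => Subtype.ext <| by
      simp [schoutenVal, mul_add, add_mul, Finset.sum_add_distrib])
    (fun c X Y => Subtype.ext <| by simp [schoutenVal, Finset.smul_sum])
    (fun X Y Y' => Subtype.ext <| by
      simp [schoutenVal, mul_add, Finset.sum_add_distrib])
    (fun c X Y => Subtype.ext <| by simp [schoutenVal, Finset.smul_sum])

/-- On decomposable multivectors,
`[X₁∧⋯∧Xₛ, Y₁∧⋯∧Yₗ] = ∑ᵢⱼ (-1)^(i+j) [Xᵢ,Yⱼ] ∧ X₁∧⋯X̂ᵢ⋯∧Xₛ ∧ Y₁∧⋯Ŷⱼ⋯∧Yₗ`. -/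
theorem schouten_ιMulti (e : Basis κ ℝ L) (p q : ℕ) (X : Fin (p + 1) → L) (Y : Fin (q + 1) → L) :
    (schouten e p q (exteriorPower.ιMulti ℝ (p + 1) X) (exteriorPower.ιMulti ℝ (q + 1) Y) :
        ExteriorAlgebra ℝ L) =
      ∑ i : Fin (p + 1), ∑ j : Fin (q + 1), (-1 : ℝ) ^ ((i : ℕ) + (j : ℕ)) •
        (ExteriorAlgebra.ι ℝ ⁅X i, Y j⁆ *
          ExteriorAlgebra.ιMulti ℝ p (fun k => X (i.succAbove k)) *
          ExteriorAlgebra.ιMulti ℝ q (fun k => Y (j.succAbove k))) := by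
  have key : ∀ u v : L, ExteriorAlgebra.ι ℝ ⁅u, v⁆ =
      ∑ a, ∑ b, (e.coord a u * e.coord b v) • ExteriorAlgebra.ι ℝ ⁅e a, e b⁆ := by
    intro u v
    conv_lhs => rw [← e.sum_repr u, ← e.sum_repr v]
    simp only [sum_lie, lie_sum, smul_lie, lie_smul, map_sum, map_smul, Finset.smul_sum, smul_smul,
      Basis.coord_apply]
    rw [Finset.sum_comm]
    simp only [mul_comm]
  change schoutenVal e (ExteriorAlgebra.ιMulti ℝ (p + 1) X) (ExteriorAlgebra.ιMulti ℝ (q + 1) Y) = _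
  set A := fun i : Fin (p + 1) => ExteriorAlgebra.ιMulti ℝ p (fun k => X (i.succAbove k)) with hA
  set B := fun j : Fin (q + 1) => ExteriorAlgebra.ιMulti ℝ q (fun k => Y (j.succAbove k)) with hB
  have hl : ∀ a b, ExteriorAlgebra.ι ℝ ⁅e a, e b⁆ *
      contract (e.coord a) (ExteriorAlgebra.ιMulti ℝ (p + 1) X) *
      contract (e.coord b) (ExteriorAlgebra.ιMulti ℝ (q + 1) Y) =
      ∑ i : Fin (p + 1), ∑ j : Fin (q + 1), (-1 : ℝ) ^ ((i : ℕ) + (j : ℕ)) •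
        (((e.coord a (X i) * e.coord b (Y j)) • ExteriorAlgebra.ι ℝ ⁅e a, e b⁆) * A i * B j) := by
    intro a b
    rw [contract_ιMulti, contract_ιMulti, Finset.mul_sum (a := ExteriorAlgebra.ι ℝ ⁅e a, e b⁆), Finset.sum_mul]
    refine Finset.sum_congr rfl fun i _ => ?_
    rw [Finset.mul_sum]
    refine Finset.sum_congr rfl fun j _ => ?_
    simp only [smul_mul_assoc, mul_smul_comm, smul_smul, hA, hB]
    congr 1
    ring
  simp only [schoutenVal, hl]
  simp only [Finset.sum_comm (s := (Finset.univ : Finset κ)) (t := (Finset.univ : Finset (Fin _)))]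
  refine Finset.sum_congr rfl fun i _ => Finset.sum_congr rfl fun j _ => ?_
  rw [key]
  simp only [Finset.sum_mul, Finset.smul_sum, hA, hB]

end Schouten

section Bialgebra

variable {L : Type*} [LieRing L] [LieAlgebra ℝ L] {κ : Type*} [Fintype κ]

/-- A vector of the Lie algebra, seen as a multivector of degree one. -/
def vec : L →ₗ[ℝ] ⋀[ℝ]^1 L := (exteriorPower.oneEquiv ℝ L).symm.toLinearMap

/-- The space `(Λ^(m+1) g)^g` of invariant multivectors of degree `m + 1`. -/
def invariants (e : Basis κ ℝ L) (m : ℕ) : Submodule ℝ (⋀[ℝ]^(m + 1) L) where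
  carrier := {w | ∀ v : L, schouten e 0 m (vec v) w = 0}
  add_mem' := fun {a b} ha hb v => by rw [map_add, ha v, hb v, add_zero]
  zero_mem' := fun v => map_zero _
  smul_mem' := fun c a ha v => by rw [map_smul, ha v, smul_zero]

/-- `(Λ² g)^g`. -/
def inv2 (e : Basis κ ℝ L) : Submodule ℝ (⋀[ℝ]^2 L) := invariants e 1

/-- `(Λ³ g)^g`. -/
def inv3 (e : Basis κ ℝ L) : Submodule ℝ (⋀[ℝ]^3 L) := invariants e 2

/-- `[r, r]_S` for a bivector `r`. -/
def schoutenSq (e : Basis κ ℝ L) (r : ⋀[ℝ]^2 L) : ⋀[ℝ]^3 L := schouten e 1 1 r r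

/-- The modified classical Yang-Baxter equation `[r, r]_S ∈ (Λ³ g)^g`. -/
def MCYBE (e : Basis κ ℝ L) (r : ⋀[ℝ]^2 L) : Prop := schoutenSq e r ∈ inv3 e

/-- The map `δ_r : v ↦ [v, r]_S`. -/
def cobracket (e : Basis κ ℝ L) (r : ⋀[ℝ]^2 L) : L →ₗ[ℝ] ⋀[ℝ]^2 L :=
  (schouten e 0 1).flip r ∘ₗ vec

/-- The transpose `δ* : Λ² g* → g*`. -/
def transpose (δ : L →ₗ[ℝ] ⋀[ℝ]^2 L) : ⋀[ℝ]^2 (Dual ℝ L) →ₗ[ℝ] Dual ℝ L :=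
  δ.dualMap ∘ₗ exteriorPower.pairingDual ℝ L 2

/-- The bracket `[θ, η] = δ*(θ ∧ η)` on `g*`, bilinear and alternating by construction. -/
def dualBracket (δ : L →ₗ[ℝ] ⋀[ℝ]^2 L) (θ η : Dual ℝ L) : Dual ℝ L :=
  transpose δ (exteriorPower.ιMulti ℝ 2 ![θ, η])

/-- `(g, δ)` is a Lie bialgebra: `δ` is a cocycle, and `δ*` is a Lie bracket on `g*`. -/
structure IsCocommutator (e : Basis κ ℝ L) (δ : L →ₗ[ℝ] ⋀[ℝ]^2 L) : Prop where
  cocycle : ∀ u v : L, δ ⁅u, v⁆ = schouten e 0 1 (vec u) (δ v) + schouten e 1 0 (δ u) (vec v)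
  jacobi : ∀ θ η ζ : Dual ℝ L,
    dualBracket δ θ (dualBracket δ η ζ) + dualBracket δ η (dualBracket δ ζ θ) +
      dualBracket δ ζ (dualBracket δ θ η) = 0

/-- `r` is an r-matrix: `(g, δ_r)` is a Lie bialgebra. -/
def IsRMatrix (e : Basis κ ℝ L) (r : ⋀[ℝ]^2 L) : Prop := IsCocommutator e (cobracket e r)

/-- `(g, δ)` is a coboundary Lie bialgebra. -/
def IsCoboundary (e : Basis κ ℝ L) (δ : L →ₗ[ℝ] ⋀[ℝ]^2 L) : Prop :=
  IsCocommutator e δ ∧ ∃ r : ⋀[ℝ]^2 L, δ = cobracket e r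

/-- `Λ² T` for a Lie algebra automorphism `T`. -/
def mapTwo (T : L ≃ₗ⁅ℝ⁆ L) : ⋀[ℝ]^2 L →ₗ[ℝ] ⋀[ℝ]^2 L :=
  exteriorPower.map 2 T.toLinearEquiv.toLinearMap

/-- Equivalence of cocommutators under Lie algebra automorphisms: `(Λ² T) ∘ δ = δ' ∘ T`. -/
def CocommutatorEquiv (δ δ' : L →ₗ[ℝ] ⋀[ℝ]^2 L) : Prop :=
  ∃ T : L ≃ₗ⁅ℝ⁆ L, ∀ v : L, mapTwo T (δ v) = δ' (T v)

/-- The classes of `r` and `r'` in `Λ²_R g = Λ² g / (Λ² g)^g` lie in one orbit of the action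
`T · [r] = [Λ² T r]` of the automorphism group. -/
def ReducedEquiv (e : Basis κ ℝ L) (r r' : ⋀[ℝ]^2 L) : Prop :=
  ∃ T : L ≃ₗ⁅ℝ⁆ L, (inv2 e).mkQ (mapTwo T r) = (inv2 e).mkQ r'

/-- All r-matrices whose cocommutator is equivalent to that of `r`. -/
def rClass (e : Basis κ ℝ L) (r : ⋀[ℝ]^2 L) : Set (⋀[ℝ]^2 L) :=
  {r' | IsRMatrix e r' ∧ CocommutatorEquiv (cobracket e r) (cobracket e r')}

/-- The classes of r-matrices, up to equivalence of their cocommutators, that belong to nonzero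
cocommutators. -/
def nonzeroClasses (e : Basis κ ℝ L) : Set (Set (⋀[ℝ]^2 L)) :=
  {C | ∃ r, IsRMatrix e r ∧ cobracket e r ≠ 0 ∧ C = rClass e r}

end Bialgebra

section Table

variable {L : Type*} [LieRing L] [LieAlgebra ℝ L]

/-- `e₁ ∧ e₂`. The basis vectors `e₁, e₂, e₃` are `e 0, e 1, e 2`. -/
def e12 (e : Basis (Fin 3) ℝ L) : ⋀[ℝ]^2 L := exteriorPower.ιMulti ℝ 2 ![e 0, e 1]

/-- `e₁ ∧ e₃`. -/
def e13 (e : Basis (Fin 3) ℝ L) : ⋀[ℝ]^2 L := exteriorPower.ιMulti ℝ 2 ![e 0, e 2]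

/-- `e₂ ∧ e₃`. -/
def e23 (e : Basis (Fin 3) ℝ L) : ⋀[ℝ]^2 L := exteriorPower.ιMulti ℝ 2 ![e 1, e 2]

/-- `e₁ ∧ e₂ ∧ e₃`. -/
def e123 (e : Basis (Fin 3) ℝ L) : ⋀[ℝ]^3 L := exteriorPower.ιMulti ℝ 3 ![e 0, e 1, e 2]

/-- `x e₁₂ + y e₁₃ + z e₂₃`. -/
def bivec (e : Basis (Fin 3) ℝ L) (x y z : ℝ) : ⋀[ℝ]^2 L := x • e12 e + y • e13 e + z • e23 e

/-- The bivectors whose coordinates `x, y, z` with respect to `e₁₂, e₁₃, e₂₃` satisfy `P`. -/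
def locus (e : Basis (Fin 3) ℝ L) (P : ℝ → ℝ → ℝ → Prop) : Set (⋀[ℝ]^2 L) :=
  {r | ∃ x y z : ℝ, P x y z ∧ r = bivec e x y z}

/-- The rows of the table: `sl₂`, `su₂`, the Heisenberg algebra, `r'_{3,0}`, `r_{3,-1}`, `r_{3,1}`,
`r₃`, `r_{3,l}` with `-1 < l < 1`, and `r'_{3,l}` with `l ≠ 0`. -/
inductive Row : Type
  | sl2
  | su2
  | heis
  | r30'
  | r3m1
  | r31
  | r3
  | r3l (l : ℝ) (hl : -1 < l ∧ l < 1)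
  | r3l' (l : ℝ) (hl : l ≠ 0)

/-- The commutation relations of a row: the values of `[e₁, e₂]`, `[e₁, e₃]` and `[e₃, e₂]`. -/
def Row.Relations (t : Row) (e : Basis (Fin 3) ℝ L) : Prop :=
  match t with
  | .sl2 => ⁅e 0, e 1⁆ = e 1 ∧ ⁅e 0, e 2⁆ = -e 2 ∧ ⁅e 2, e 1⁆ = -e 0
  | .su2 => ⁅e 0, e 1⁆ = e 2 ∧ ⁅e 0, e 2⁆ = -e 1 ∧ ⁅e 2, e 1⁆ = -e 0
  | .heis => ⁅e 0, e 1⁆ = e 2 ∧ ⁅e 0, e 2⁆ = 0 ∧ ⁅e 2, e 1⁆ = 0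
  | .r30' => ⁅e 0, e 1⁆ = -e 2 ∧ ⁅e 0, e 2⁆ = e 1 ∧ ⁅e 2, e 1⁆ = 0
  | .r3m1 => ⁅e 0, e 1⁆ = e 1 ∧ ⁅e 0, e 2⁆ = -e 2 ∧ ⁅e 2, e 1⁆ = 0
  | .r31 => ⁅e 0, e 1⁆ = e 1 ∧ ⁅e 0, e 2⁆ = e 2 ∧ ⁅e 2, e 1⁆ = 0
  | .r3 => ⁅e 0, e 1⁆ = 0 ∧ ⁅e 0, e 2⁆ = -e 0 ∧ ⁅e 2, e 1⁆ = e 0 + e 1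
  | .r3l l _ => ⁅e 0, e 1⁆ = 0 ∧ ⁅e 0, e 2⁆ = -e 0 ∧ ⁅e 2, e 1⁆ = l • e 1
  | .r3l' l _ => ⁅e 0, e 1⁆ = 0 ∧ ⁅e 0, e 2⁆ = e 1 - l • e 0 ∧ ⁅e 2, e 1⁆ = l • e 1 + e 0

/-- The space of invariant bivectors of a row. -/
def Row.inv2 (t : Row) (e : Basis (Fin 3) ℝ L) : Submodule ℝ (⋀[ℝ]^2 L) :=
  match t with
  | .heis => Submodule.span ℝ {e13 e, e23 e}
  | .r30' => Submodule.span ℝ {e23 e}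
  | .r3m1 => Submodule.span ℝ {e23 e}
  | _ => ⊥

/-- The space of invariant trivectors of a row. -/
def Row.inv3 (t : Row) (L : Type*) [LieRing L] [LieAlgebra ℝ L] : Submodule ℝ (⋀[ℝ]^3 L) :=
  match t with
  | .sl2 => ⊤
  | .su2 => ⊤
  | .heis => ⊤
  | .r30' => ⊤
  | .r3m1 => ⊤
  | _ => ⊥

/-- The coefficient of `e₁₂₃` in `[r, r]_S` for `r = x e₁₂ + y e₁₃ + z e₂₃`. -/
def Row.schoutenCoeff (t : Row) (x y z : ℝ) : ℝ :=
  match t with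
  | .sl2 => 2 * z ^ 2 - 4 * x * y
  | .su2 => 2 * (x ^ 2 + y ^ 2 + z ^ 2)
  | .heis => 2 * x ^ 2
  | .r30' => -2 * (x ^ 2 + y ^ 2)
  | .r3m1 => -4 * x * y
  | .r31 => 0
  | .r3 => -2 * z ^ 2
  | .r3l l _ => 2 * (l - 1) * y * z
  | .r3l' _ _ => -2 * (y ^ 2 + z ^ 2)

/-- The solution set of the modified classical Yang-Baxter equation of a row, in coordinates. -/
def Row.YB (t : Row) (_x y z : ℝ) : Prop :=
  match t with
  | .r3 => z = 0
  | .r3l _ _ => y = 0 ∨ z = 0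
  | .r3l' _ _ => y = 0 ∧ z = 0
  | _ => True

/-- The classes of r-matrices of a row that belong to nonzero cocommutators. -/
def Row.classes (t : Row) (e : Basis (Fin 3) ℝ L) : Set (Set (⋀[ℝ]^2 L)) :=
  match t with
  | .sl2 =>
      {C | ∃ k : ℝ, k ≠ 0 ∧ C = locus e fun x y z => 2 * x * y - z ^ 2 = k} ∪
        {locus e fun x y z => 2 * x * y - z ^ 2 = 0 ∧ x ^ 2 + y ^ 2 ≠ 0}
  | .su2 => {C | ∃ k : ℝ, 0 < k ∧ C = locus e fun x y z => x ^ 2 + y ^ 2 + z ^ 2 = k}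
  | .heis => {locus e fun x _ _ => x ≠ 0}
  | .r30' => {locus e fun x y _ => 0 < x ^ 2 + y ^ 2}
  | .r3m1 => {locus e fun x y _ => x * y = 0 ∧ x ^ 2 + y ^ 2 ≠ 0, locus e fun x y _ => x * y ≠ 0}
  | .r31 => {locus e fun x y _ => x ^ 2 + y ^ 2 ≠ 0, locus e fun x y z => x = 0 ∧ y = 0 ∧ z ≠ 0}
  | .r3 =>
      {locus e fun x y z => 0 < x ∧ y = 0 ∧ z = 0, locus e fun x y z => x < 0 ∧ y = 0 ∧ z = 0,
        locus e fun _ y z => y ≠ 0 ∧ z = 0}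
  | .r3l _ _ =>
      {locus e fun _ y z => y = 0 ∧ z ≠ 0, locus e fun _ y z => z = 0 ∧ y ≠ 0,
        locus e fun x y z => y = 0 ∧ z = 0 ∧ x ≠ 0}
  | .r3l' _ _ =>
      {locus e fun x y z => 0 < x ∧ y = 0 ∧ z = 0, locus e fun x y z => x < 0 ∧ y = 0 ∧ z = 0}

/-- Representatives of the classes of a row. -/
def Row.reps (t : Row) (e : Basis (Fin 3) ℝ L) : Set (⋀[ℝ]^2 L) :=
  match t with
  | .sl2 =>
      {r | ∃ a : ℝ, 0 < a ∧ r = a • e23 e} ∪ {r | ∃ a : ℝ, 0 < a ∧ r = a • (e12 e + e13 e)} ∪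
        {e12 e}
  | .su2 => {r | ∃ a : ℝ, 0 < a ∧ r = a • e12 e}
  | .heis => {e12 e}
  | .r30' => {e12 e}
  | .r3m1 => {e12 e, e12 e - e13 e}
  | .r31 => {e13 e, e23 e}
  | .r3 => {e12 e, -e12 e, e13 e}
  | .r3l _ _ => {e12 e, e23 e, e13 e}
  | .r3l' _ _ => {e12 e, -e12 e}

end Table

end CoboundaryLie

end

open Module

noncomputable section

namespace CoboundaryLie

/-! ### Schouten brackets of decomposables, coboundary cocycles, equivalence of cobrackets -/

section Wedge

variable {L : Type*} [LieRing L] [LieAlgebra ℝ L] {κ : Type*} [Fintype κ]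

/-! The bracket with a vector is the natural action of the Lie algebra on multivectors, so δ_r(v) =
v · r. Hence every δ_r is a cocycle (`cobracket_cocycle`), and r ↦ δ_r is linear with kernel
(Λ²g)^g. An automorphism T carries δ_r to δ_{(Λ²T) r} (`mapTwo_cobracket`). Together these give the
passage from equivalent cocommutators to orbits in Λ²g/(Λ²g)^g (`cocommutatorEquiv_iff`).

The rest is a computation with nine structure constants. The predicate `Brackets.Holds` records them
for a basis, and general formulas give δ_r, [r, r], the action on Λ³g (which is by the trace of ad)
and the Jacobi identity for δ_r. The mCYBE and the r-matrix condition are computed separately, and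
for every row they cut out the same locus. Automorphisms are the changes of basis that preserve the
structure constants (`exists_lieEquiv`), so equivalence of bivectors becomes a polynomial system in
nine matrix entries.

To classify, it suffices to cover the non-invariant r-matrices by loci, to move each point of a
locus to its representative, and to separate the representatives (`classes_of_family`). Explicit
automorphisms do the moving. The matrix equations do the separating, aided by the invariance of tr
ad in non-unimodular rows. For sl₂ the separating invariant 2xy - z² is the Killing form,
transported along the bracket map Λ²g → g.

Completeness of the table splits on tr ad. If it vanishes, the bracket map, read through the cross
product, is a symmetric matrix. The spectral theorem diagonalizes it, and the signs of the
eigenvalues decide the row (`hasRow_of_unimodular`). If it does not vanish, its kernel is an abelian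
ideal of dimension two. The algebra is then ℝ ⋉ ℝ², and the normal form of one 2 × 2 matrix of
nonzero trace, up to scaling, decides (`hasRow_of_trace_ne_zero`). -/

/-- The bivector `u ∧ v`. -/
def wedge (u v : L) : ⋀[ℝ]^2 L := exteriorPower.ιMulti ℝ 2 ![u, v]

/-- The trivector `u ∧ v ∧ w`. -/
def wedge₃ (u v w : L) : ⋀[ℝ]^3 L := exteriorPower.ιMulti ℝ 3 ![u, v, w]

theorem coe_wedge (u v : L) :
    (wedge u v : ExteriorAlgebra ℝ L) = ExteriorAlgebra.ι ℝ u * ExteriorAlgebra.ι ℝ v := by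
  simp [wedge, ExteriorAlgebra.ιMulti_succ_apply]

theorem coe_wedge₃ (u v w : L) : (wedge₃ u v w : ExteriorAlgebra ℝ L) =
    ExteriorAlgebra.ι ℝ u * ExteriorAlgebra.ι ℝ v * ExteriorAlgebra.ι ℝ w := by
  simp [wedge₃, ExteriorAlgebra.ιMulti_succ_apply, Matrix.vecTail, Function.comp_def, mul_assoc]

theorem wedge_add_left (u u' v : L) : wedge (u + u') v = wedge u v + wedge u' v :=
  Subtype.ext <| by simp [coe_wedge, add_mul]

theorem wedge_add_right (u v v' : L) : wedge u (v + v') = wedge u v + wedge u v' :=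
  Subtype.ext <| by simp [coe_wedge, mul_add]

theorem wedge_smul_left (c : ℝ) (u v : L) : wedge (c • u) v = c • wedge u v :=
  Subtype.ext <| by simp [coe_wedge]

theorem wedge_smul_right (c : ℝ) (u v : L) : wedge u (c • v) = c • wedge u v :=
  Subtype.ext <| by simp [coe_wedge]

theorem wedge_neg_left (u v : L) : wedge (-u) v = -wedge u v :=
  Subtype.ext <| by simp [coe_wedge]

theorem wedge_neg_right (u v : L) : wedge u (-v) = -wedge u v :=
  Subtype.ext <| by simp [coe_wedge]

theorem wedge_self (u : L) : wedge u u = 0 :=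
  Subtype.ext <| by simp [coe_wedge]

theorem wedge_swap (u v : L) : wedge v u = -wedge u v := by
  have h := wedge_self (u + v)
  rw [wedge_add_left, wedge_add_right, wedge_add_right, wedge_self, wedge_self] at h
  rw [eq_neg_iff_add_eq_zero, ← h]
  abel

theorem wedge₃_add_left (u u' v w : L) : wedge₃ (u + u') v w = wedge₃ u v w + wedge₃ u' v w :=
  Subtype.ext <| by simp [coe_wedge₃, add_mul]

theorem wedge₃_add_mid (u v v' w : L) : wedge₃ u (v + v') w = wedge₃ u v w + wedge₃ u v' w :=
  Subtype.ext <| by simp [coe_wedge₃, add_mul, mul_add]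

theorem wedge₃_add_right (u v w w' : L) : wedge₃ u v (w + w') = wedge₃ u v w + wedge₃ u v w' :=
  Subtype.ext <| by simp [coe_wedge₃, mul_add]

theorem wedge₃_smul_left (c : ℝ) (u v w : L) : wedge₃ (c • u) v w = c • wedge₃ u v w :=
  Subtype.ext <| by simp [coe_wedge₃]

theorem wedge₃_smul_mid (c : ℝ) (u v w : L) : wedge₃ u (c • v) w = c • wedge₃ u v w :=
  Subtype.ext <| by simp [coe_wedge₃]

theorem wedge₃_smul_right (c : ℝ) (u v w : L) : wedge₃ u v (c • w) = c • wedge₃ u v w :=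
  Subtype.ext <| by simp [coe_wedge₃]

theorem wedge₃_self_left (u w : L) : wedge₃ u u w = 0 :=
  Subtype.ext <| by simp [coe_wedge₃]

theorem wedge₃_self_right (u v : L) : wedge₃ u v v = 0 :=
  Subtype.ext <| by simp [coe_wedge₃, mul_assoc]

theorem wedge₃_swap_left (u v w : L) : wedge₃ v u w = -wedge₃ u v w := by
  have h := wedge₃_self_left (u + v) w
  rw [wedge₃_add_left, wedge₃_add_mid, wedge₃_add_mid, wedge₃_self_left, wedge₃_self_left] at h
  rw [eq_neg_iff_add_eq_zero, ← h]
  abel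

theorem wedge₃_swap_right (u v w : L) : wedge₃ u w v = -wedge₃ u v w := by
  have h := wedge₃_self_right u (v + w)
  rw [wedge₃_add_mid, wedge₃_add_right, wedge₃_add_right, wedge₃_self_right,
    wedge₃_self_right] at h
  rw [eq_neg_iff_add_eq_zero, ← h]
  abel

theorem wedge₃_self_outer (u v : L) : wedge₃ u v u = 0 := by
  rw [wedge₃_swap_right, wedge₃_self_left, neg_zero]

theorem span_wedge : Submodule.span ℝ (Set.range fun p : L × L => wedge p.1 p.2) = ⊤ := by
  rw [eq_top_iff, ← exteriorPower.ιMulti_span ℝ 2 L, Submodule.span_le]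
  rintro _ ⟨v, rfl⟩
  refine Submodule.subset_span ⟨(v 0, v 1), ?_⟩
  simp only [wedge]
  congr 1
  ext i
  fin_cases i <;> rfl

@[elab_as_elim]
theorem wedge_induction {P : ⋀[ℝ]^2 L → Prop} (r : ⋀[ℝ]^2 L) (wedge : ∀ u v, P (wedge u v))
    (zero : P 0) (add : ∀ r s, P r → P s → P (r + s)) (smul : ∀ (c : ℝ) r, P r → P (c • r)) :
    P r := by
  have hr : r ∈ Submodule.span ℝ (Set.range fun p : L × L => CoboundaryLie.wedge p.1 p.2) := by
    rw [span_wedge]; trivial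
  induction hr using Submodule.span_induction with
  | mem x hx => obtain ⟨p, rfl⟩ := hx; exact wedge _ _
  | zero => exact zero
  | add x y _ _ hx hy => exact add _ _ hx hy
  | smul c x _ hx => exact smul _ _ hx

theorem vec_eq_ιMulti (v : L) : vec v = exteriorPower.ιMulti ℝ 1 ![v] := by
  rw [vec, LinearEquiv.coe_coe, LinearEquiv.symm_apply_eq, exteriorPower.oneEquiv_ιMulti]
  rfl

theorem schouten_vec_wedge (e : Basis κ ℝ L) (v a b : L) :
    schouten e 0 1 (vec v) (wedge a b) = wedge ⁅v, a⁆ b + wedge a ⁅v, b⁆ := by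
  -- The Schouten formula always puts the bracket in the first slot; the swap accounts for its sign.
  have h : wedge a ⁅v, b⁆ = -wedge ⁅v, b⁆ a := wedge_swap _ _
  rw [h]
  refine Subtype.ext ?_
  rw [vec_eq_ιMulti, wedge, schouten_ιMulti]
  simp [coe_wedge, Fin.sum_univ_two, ExteriorAlgebra.ιMulti_succ_apply, Fin.succAbove]

theorem schouten_wedge_vec (e : Basis κ ℝ L) (v a b : L) :
    schouten e 1 0 (wedge a b) (vec v) = -(wedge ⁅v, a⁆ b + wedge a ⁅v, b⁆) := by
  have h : wedge a ⁅v, b⁆ = -wedge ⁅v, b⁆ a := wedge_swap _ _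
  rw [h]
  refine Subtype.ext ?_
  rw [vec_eq_ιMulti, wedge, schouten_ιMulti]
  simp [coe_wedge, Fin.sum_univ_two, ExteriorAlgebra.ιMulti_succ_apply, Fin.succAbove]
  rw [← lie_skew v a, ← lie_skew v b, map_neg, map_neg]
  simp only [neg_mul]
  abel

theorem schouten_vec_wedge₃ (e : Basis κ ℝ L) (v a b c : L) :
    schouten e 0 2 (vec v) (wedge₃ a b c) =
      wedge₃ ⁅v, a⁆ b c + wedge₃ a ⁅v, b⁆ c + wedge₃ a b ⁅v, c⁆ := by
  rw [wedge₃_swap_left ⁅v, b⁆ a c, wedge₃_swap_right a ⁅v, c⁆ b, wedge₃_swap_left ⁅v, c⁆ a b, neg_neg]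
  refine Subtype.ext ?_
  rw [vec_eq_ιMulti, wedge₃, schouten_ιMulti]
  simp [coe_wedge₃, Fin.sum_univ_three, ExteriorAlgebra.ιMulti_succ_apply, Fin.succAbove,
    Matrix.vecTail, Function.comp_def, mul_assoc]

theorem schouten_wedge_wedge (e : Basis κ ℝ L) (a b c d : L) :
    schouten e 1 1 (wedge a b) (wedge c d) =
      wedge₃ ⁅a, c⁆ b d - wedge₃ ⁅a, d⁆ b c - wedge₃ ⁅b, c⁆ a d + wedge₃ ⁅b, d⁆ a c := by
  refine Subtype.ext ?_
  rw [wedge, wedge, schouten_ιMulti]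
  simp [coe_wedge₃, Fin.sum_univ_two, ExteriorAlgebra.ιMulti_succ_apply, Fin.succAbove]
  abel

theorem cobracket_apply (e : Basis κ ℝ L) (r : ⋀[ℝ]^2 L) (v : L) :
    cobracket e r v = schouten e 0 1 (vec v) r := rfl

theorem cobracket_add (e : Basis κ ℝ L) (r s : ⋀[ℝ]^2 L) :
    cobracket e (r + s) = cobracket e r + cobracket e s := by
  ext v; simp [cobracket_apply]

theorem cobracket_smul (e : Basis κ ℝ L) (c : ℝ) (r : ⋀[ℝ]^2 L) :
    cobracket e (c • r) = c • cobracket e r := by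
  ext v; simp [cobracket_apply]

theorem cobracket_zero (e : Basis κ ℝ L) : cobracket e (0 : ⋀[ℝ]^2 L) = 0 := by
  ext v; simp [cobracket_apply]

theorem cobracket_sub (e : Basis κ ℝ L) (r s : ⋀[ℝ]^2 L) :
    cobracket e (r - s) = cobracket e r - cobracket e s := by
  ext v; simp [cobracket_apply]

theorem cobracket_wedge (e : Basis κ ℝ L) (a b v : L) :
    cobracket e (wedge a b) v = wedge ⁅v, a⁆ b + wedge a ⁅v, b⁆ :=
  schouten_vec_wedge e v a b

theorem mem_inv2_iff (e : Basis κ ℝ L) (r : ⋀[ℝ]^2 L) : r ∈ inv2 e ↔ cobracket e r = 0 :=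
  ⟨fun h => LinearMap.ext h, fun h v => LinearMap.congr_fun h v⟩

theorem schouten_vec_right (e : Basis κ ℝ L) (r : ⋀[ℝ]^2 L) (v : L) :
    schouten e 1 0 r (vec v) = -schouten e 0 1 (vec v) r := by
  induction r using wedge_induction with
  | wedge a b => rw [schouten_wedge_vec, schouten_vec_wedge]
  | zero => simp
  | add r s hr hs => rw [map_add, map_add, LinearMap.add_apply, hr, hs]; abel
  | smul c r hr => rw [map_smul, map_smul, LinearMap.smul_apply, hr, smul_neg]

/-- The action on bivectors is a representation: [u, v] · r = u · (v · r) - v · (u · r), which is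
the Jacobi identity on each factor of a decomposable r. -/
theorem cobracket_cocycle (e : Basis κ ℝ L) (r : ⋀[ℝ]^2 L) (u v : L) :
    cobracket e r ⁅u, v⁆ =
      schouten e 0 1 (vec u) (cobracket e r v) + schouten e 1 0 (cobracket e r u) (vec v) := by
  rw [schouten_vec_right, ← sub_eq_add_neg]
  induction r using wedge_induction with
  | wedge a b =>
    simp only [cobracket_wedge, map_add, schouten_vec_wedge, lie_lie, sub_eq_add_neg,
      wedge_add_left, wedge_add_right]
    rw [wedge_neg_left, wedge_neg_right]
    abel
  | zero => simp [cobracket_zero]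
  | add r s hr hs => simp only [cobracket_add, LinearMap.add_apply, hr, hs, map_add]; abel
  | smul c r hr => simp only [cobracket_smul, LinearMap.smul_apply, hr, map_smul, smul_sub]

theorem mapTwo_wedge (T : L ≃ₗ⁅ℝ⁆ L) (u v : L) : mapTwo T (wedge u v) = wedge (T u) (T v) := by
  rw [mapTwo, wedge, exteriorPower.map_apply_ιMulti, wedge]
  congr 1
  ext i
  fin_cases i <;> rfl

theorem mapTwo_cobracket (e : Basis κ ℝ L) (T : L ≃ₗ⁅ℝ⁆ L) (r : ⋀[ℝ]^2 L) (v : L) :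
    mapTwo T (cobracket e r v) = cobracket e (mapTwo T r) (T v) := by
  induction r using wedge_induction with
  | wedge a b => simp only [cobracket_wedge, map_add, mapTwo_wedge, LieEquiv.map_lie]
  | zero => simp [cobracket_zero]
  | add r s hr hs => simp only [cobracket_add, LinearMap.add_apply, map_add, hr, hs]
  | smul c r hr => simp only [cobracket_smul, LinearMap.smul_apply, map_smul, hr]

/-- The same T works on both sides. Since T is onto and intertwines δ_r with δ_{(Λ²T) r}, the
equivalence says that (Λ²T) r and r' have the same cobracket, that is, that they differ by an
invariant. -/
theorem cocommutatorEquiv_iff (e : Basis κ ℝ L) (r r' : ⋀[ℝ]^2 L) :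
    CocommutatorEquiv (cobracket e r) (cobracket e r') ↔ ReducedEquiv e r r' := by
  refine exists_congr fun T => ?_
  have key : mapTwo T r - r' ∈ inv2 e ↔ cobracket e (mapTwo T r) = cobracket e r' := by
    rw [mem_inv2_iff, cobracket_sub]
    exact sub_eq_zero (a := cobracket e (mapTwo T r))
  rw [Submodule.mkQ_apply, Submodule.mkQ_apply, Submodule.Quotient.eq, key]
  refine ⟨fun h => LinearMap.ext fun v => ?_, fun h v => ?_⟩
  · obtain ⟨u, rfl⟩ : ∃ u, T u = v := ⟨T.symm v, by simp⟩
    rw [← h, mapTwo_cobracket]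
  · rw [mapTwo_cobracket, h]

theorem mapTwo_trans (T S : L ≃ₗ⁅ℝ⁆ L) (r : ⋀[ℝ]^2 L) :
    mapTwo (T.trans S) r = mapTwo S (mapTwo T r) := by
  induction r using wedge_induction with
  | wedge a b => simp [mapTwo_wedge]
  | zero => simp
  | add r s hr hs => rw [map_add, hr, hs, map_add, map_add]
  | smul c r hr => rw [map_smul, hr, map_smul, map_smul]

theorem mapTwo_refl (r : ⋀[ℝ]^2 L) : mapTwo (LieEquiv.refl : L ≃ₗ⁅ℝ⁆ L) r = r := by
  induction r using wedge_induction with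
  | wedge a b => simp [mapTwo_wedge]
  | zero => simp
  | add r s hr hs => rw [map_add, hr, hs]
  | smul c r hr => rw [map_smul, hr]

theorem CocommutatorEquiv.symm {δ δ' : L →ₗ[ℝ] ⋀[ℝ]^2 L} (h : CocommutatorEquiv δ δ') :
    CocommutatorEquiv δ' δ := by
  obtain ⟨T, hT⟩ := h
  refine ⟨T.symm, fun v => ?_⟩
  obtain ⟨u, rfl⟩ : ∃ u, T u = v := ⟨T.symm v, by simp⟩
  rw [← hT, ← mapTwo_trans, LieEquiv.symm_apply_apply]
  have : T.trans T.symm = LieEquiv.refl := by ext x; simp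
  rw [this, mapTwo_refl]

theorem CocommutatorEquiv.trans {δ δ' δ'' : L →ₗ[ℝ] ⋀[ℝ]^2 L} (h : CocommutatorEquiv δ δ')
    (h' : CocommutatorEquiv δ' δ'') : CocommutatorEquiv δ δ'' := by
  obtain ⟨T, hT⟩ := h
  obtain ⟨S, hS⟩ := h'
  exact ⟨T.trans S, fun v => by rw [mapTwo_trans, hT, hS, LieEquiv.trans_apply]⟩

/-- Passing through cocommutators avoids showing that automorphisms preserve the invariant
bivectors. -/
theorem ReducedEquiv.symm {e : Basis κ ℝ L} {r r' : ⋀[ℝ]^2 L} (h : ReducedEquiv e r r') :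
    ReducedEquiv e r' r :=
  (cocommutatorEquiv_iff e _ _).1 ((cocommutatorEquiv_iff e _ _).2 h).symm

theorem ReducedEquiv.trans {e : Basis κ ℝ L} {r r' r'' : ⋀[ℝ]^2 L} (h : ReducedEquiv e r r')
    (h' : ReducedEquiv e r' r'') : ReducedEquiv e r r'' :=
  (cocommutatorEquiv_iff e _ _).1
    (((cocommutatorEquiv_iff e _ _).2 h).trans ((cocommutatorEquiv_iff e _ _).2 h'))

end Wedge

section

/-! ### Coordinates of vectors, bivectors and trivectors -/

section Coordinates

variable {L : Type*} [LieRing L] [LieAlgebra ℝ L]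

/-- The vector `a e₁ + b e₂ + c e₃`. -/
def lin (e : Basis (Fin 3) ℝ L) (a b c : ℝ) : L := a • e 0 + b • e 1 + c • e 2

theorem exists_lin (e : Basis (Fin 3) ℝ L) (v : L) : ∃ a b c, v = lin e a b c :=
  ⟨_, _, _, by simpa only [Fin.sum_univ_three, lin] using (e.sum_repr v).symm⟩

theorem basis_zero_eq_lin (e : Basis (Fin 3) ℝ L) : e 0 = lin e 1 0 0 := by simp [lin]

theorem basis_one_eq_lin (e : Basis (Fin 3) ℝ L) : e 1 = lin e 0 1 0 := by simp [lin]

theorem basis_two_eq_lin (e : Basis (Fin 3) ℝ L) : e 2 = lin e 0 0 1 := by simp [lin]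

theorem lin_inj (e : Basis (Fin 3) ℝ L) {a b c a' b' c' : ℝ} :
    lin e a b c = lin e a' b' c' ↔ a = a' ∧ b = b' ∧ c = c' := by
  refine ⟨fun h => ?_, by rintro ⟨rfl, rfl, rfl⟩; rfl⟩
  have h' := congrArg e.repr h
  refine ⟨?_, ?_, ?_⟩
  · simpa [lin, Finsupp.single_apply] using DFunLike.congr_fun h' 0
  · simpa [lin, Finsupp.single_apply] using DFunLike.congr_fun h' 1
  · simpa [lin, Finsupp.single_apply] using DFunLike.congr_fun h' 2

theorem lin_eq_zero_iff (e : Basis (Fin 3) ℝ L) {a b c : ℝ} :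
    lin e a b c = 0 ↔ a = 0 ∧ b = 0 ∧ c = 0 := by
  rw [← lin_inj e]
  simp [lin]

theorem wedge_lin (e : Basis (Fin 3) ℝ L) (a b c a' b' c' : ℝ) :
    wedge (lin e a b c) (lin e a' b' c') =
      bivec e (a * b' - b * a') (a * c' - c * a') (b * c' - c * b') := by
  simp only [lin, wedge_add_left, wedge_add_right, wedge_smul_left, wedge_smul_right, wedge_self,
    wedge_swap (e 0) (e 1), wedge_swap (e 0) (e 2), wedge_swap (e 1) (e 2)]
  change _ = _ • wedge (e 0) (e 1) + _ • wedge (e 0) (e 2) + _ • wedge (e 1) (e 2)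
  module

theorem wedge₃_lin (e : Basis (Fin 3) ℝ L) (a b c a' b' c' a'' b'' c'' : ℝ) :
    wedge₃ (lin e a b c) (lin e a' b' c') (lin e a'' b'' c'') =
      (a * (b' * c'' - c' * b'') - b * (a' * c'' - c' * a'') + c * (a' * b'' - b' * a'')) •
        e123 e := by
  have h1 := wedge₃_swap_right (e 0) (e 1) (e 2)
  have h2 := wedge₃_swap_left (e 0) (e 1) (e 2)
  have h3 : wedge₃ (e 1) (e 2) (e 0) = wedge₃ (e 0) (e 1) (e 2) := by
    rw [wedge₃_swap_right, h2, neg_neg]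
  have h4 : wedge₃ (e 2) (e 0) (e 1) = wedge₃ (e 0) (e 1) (e 2) := by
    rw [wedge₃_swap_left, h1, neg_neg]
  have h5 : wedge₃ (e 2) (e 1) (e 0) = -wedge₃ (e 0) (e 1) (e 2) := by
    rw [wedge₃_swap_left, h3]
  simp only [lin, wedge₃_add_left, wedge₃_add_mid, wedge₃_add_right, wedge₃_smul_left,
    wedge₃_smul_mid, wedge₃_smul_right, wedge₃_self_left, wedge₃_self_right, wedge₃_self_outer,
    h1, h2, h3, h4, h5]
  change _ = _ • wedge₃ (e 0) (e 1) (e 2)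
  module

theorem bivec_add (e : Basis (Fin 3) ℝ L) (x y z x' y' z' : ℝ) :
    bivec e x y z + bivec e x' y' z' = bivec e (x + x') (y + y') (z + z') := by
  simp only [bivec]; module

theorem bivec_sub (e : Basis (Fin 3) ℝ L) (x y z x' y' z' : ℝ) :
    bivec e x y z - bivec e x' y' z' = bivec e (x - x') (y - y') (z - z') := by
  simp only [bivec]; module

theorem bivec_smul (e : Basis (Fin 3) ℝ L) (c x y z : ℝ) :
    c • bivec e x y z = bivec e (c * x) (c * y) (c * z) := by
  simp only [bivec]; module

theorem bivec_zero (e : Basis (Fin 3) ℝ L) : bivec e 0 0 0 = 0 := by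
  simp only [bivec]; module

theorem e12_eq_bivec (e : Basis (Fin 3) ℝ L) : e12 e = bivec e 1 0 0 := by
  simp only [bivec]; module

theorem e13_eq_bivec (e : Basis (Fin 3) ℝ L) : e13 e = bivec e 0 1 0 := by
  simp only [bivec]; module

theorem e23_eq_bivec (e : Basis (Fin 3) ℝ L) : e23 e = bivec e 0 0 1 := by
  simp only [bivec]; module

theorem neg_bivec (e : Basis (Fin 3) ℝ L) (x y z : ℝ) :
    -bivec e x y z = bivec e (-x) (-y) (-z) := by
  simp only [bivec]; module

theorem exists_bivec (e : Basis (Fin 3) ℝ L) (r : ⋀[ℝ]^2 L) : ∃ x y z, r = bivec e x y z := by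
  induction r using wedge_induction with
  | wedge u v =>
    obtain ⟨a, b, c, rfl⟩ := exists_lin e u
    obtain ⟨a', b', c', rfl⟩ := exists_lin e v
    exact ⟨_, _, _, wedge_lin e _ _ _ _ _ _⟩
  | zero => exact ⟨0, 0, 0, (bivec_zero e).symm⟩
  | add r s hr hs =>
    obtain ⟨x, y, z, rfl⟩ := hr
    obtain ⟨x', y', z', rfl⟩ := hs
    exact ⟨_, _, _, bivec_add e _ _ _ _ _ _⟩
  | smul c r hr =>
    obtain ⟨x, y, z, rfl⟩ := hr
    exact ⟨_, _, _, bivec_smul e _ _ _ _⟩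

theorem exists_smul_e123 (e : Basis (Fin 3) ℝ L) (w : ⋀[ℝ]^3 L) : ∃ c : ℝ, w = c • e123 e := by
  have hw : w ∈ Submodule.span ℝ (Set.range (exteriorPower.ιMulti ℝ 3 (M := L))) := by
    rw [exteriorPower.ιMulti_span]; trivial
  induction hw using Submodule.span_induction with
  | mem x hx =>
    obtain ⟨v, rfl⟩ := hx
    obtain ⟨a, b, c, h0⟩ := exists_lin e (v 0)
    obtain ⟨a', b', c', h1⟩ := exists_lin e (v 1)
    obtain ⟨a'', b'', c'', h2⟩ := exists_lin e (v 2)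
    have hv : v = ![lin e a b c, lin e a' b' c', lin e a'' b'' c''] := by
      ext i; fin_cases i <;> simp [h0, h1, h2]
    rw [hv]
    exact ⟨_, wedge₃_lin e _ _ _ _ _ _ _ _ _⟩
  | zero => exact ⟨0, (zero_smul ℝ _).symm⟩
  | add x y _ _ hx hy =>
    obtain ⟨c, rfl⟩ := hx
    obtain ⟨d, rfl⟩ := hy
    exact ⟨c + d, (add_smul c d _).symm⟩
  | smul d x _ hx =>
    obtain ⟨c, rfl⟩ := hx
    exact ⟨d * c, smul_smul d c _⟩

theorem pairingDual_bivec (e : Basis (Fin 3) ℝ L) (θ η : Dual ℝ L) (x y z : ℝ) :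
    exteriorPower.pairingDual ℝ L 2 (exteriorPower.ιMulti ℝ 2 ![θ, η]) (bivec e x y z) =
      x * (θ (e 0) * η (e 1) - θ (e 1) * η (e 0)) + y * (θ (e 0) * η (e 2) - θ (e 2) * η (e 0)) +
        z * (θ (e 1) * η (e 2) - θ (e 2) * η (e 1)) := by
  simp only [bivec, e12, e13, e23, map_add, map_smul, exteriorPower.pairingDual_ιMulti_ιMulti,
    Matrix.det_fin_two, Matrix.of_apply, smul_eq_mul]
  simp
  ring

/-- Pairing with eᵢ* ∧ eⱼ* reads off the coordinates. -/
theorem bivec_inj (e : Basis (Fin 3) ℝ L) {x y z x' y' z' : ℝ} :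
    bivec e x y z = bivec e x' y' z' ↔ x = x' ∧ y = y' ∧ z = z' := by
  refine ⟨fun h => ?_, by rintro ⟨rfl, rfl, rfl⟩; rfl⟩
  have key (i j : Fin 3) := congrArg
    (exteriorPower.pairingDual ℝ L 2 (exteriorPower.ιMulti ℝ 2 ![e.coord i, e.coord j])) h
  simp only [pairingDual_bivec] at key
  refine ⟨?_, ?_, ?_⟩
  · simpa [Finsupp.single_apply] using key 0 1
  · simpa [Finsupp.single_apply] using key 0 2
  · simpa [Finsupp.single_apply] using key 1 2

theorem bivec_eq_zero_iff (e : Basis (Fin 3) ℝ L) {x y z : ℝ} :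
    bivec e x y z = 0 ↔ x = 0 ∧ y = 0 ∧ z = 0 := by
  rw [← bivec_zero e, bivec_inj]

theorem e123_ne_zero (e : Basis (Fin 3) ℝ L) : e123 e ≠ 0 := by
  intro h
  have key := congrArg
    (exteriorPower.pairingDual ℝ L 3 (exteriorPower.ιMulti ℝ 3 ![e.coord 0, e.coord 1, e.coord 2])) h
  rw [e123, exteriorPower.pairingDual_ιMulti_ιMulti, Matrix.det_fin_three,
    LinearMap.map_zero] at key
  simp at key

theorem smul_e123_eq_zero_iff (e : Basis (Fin 3) ℝ L) {c : ℝ} : c • e123 e = 0 ↔ c = 0 :=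
  ⟨fun h => (smul_eq_zero.1 h).resolve_right (e123_ne_zero e), fun h => by rw [h]; exact zero_smul ℝ _⟩

theorem mem_locus_iff (e : Basis (Fin 3) ℝ L) (P : ℝ → ℝ → ℝ → Prop) (x y z : ℝ) :
    bivec e x y z ∈ locus e P ↔ P x y z := by
  refine ⟨?_, fun h => ⟨x, y, z, h, rfl⟩⟩
  rintro ⟨x', y', z', h, h'⟩
  obtain ⟨rfl, rfl, rfl⟩ := (bivec_inj e).1 h'
  exact h

theorem setOf_eq_locus (e : Basis (Fin 3) ℝ L) (p : ⋀[ℝ]^2 L → Prop) (P : ℝ → ℝ → ℝ → Prop)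
    (h : ∀ x y z, p (bivec e x y z) ↔ P x y z) : {r | p r} = locus e P := by
  ext r
  obtain ⟨x, y, z, rfl⟩ := exists_bivec e r
  rw [mem_locus_iff, ← h]
  rfl

end Coordinates

/-! ### Structure constants and the formulas they determine -/

/-- The coordinates of `[e₁, e₂]`, `[e₁, e₃]` and `[e₃, e₂]` in a basis `e`. -/
structure Brackets where
  (a₁ a₂ a₃ b₁ b₂ b₃ c₁ c₂ c₃ : ℝ)

/-- The coefficient of `e₁₂₃` in `[r, r]` for `r = x e₁₂ + y e₁₃ + z e₂₃`. -/
def Brackets.sqCoeff (s : Brackets) (x y z : ℝ) : ℝ :=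
  2 * (s.a₃ * x ^ 2 - s.b₂ * y ^ 2 - s.c₁ * z ^ 2 + (s.b₃ - s.a₂) * x * y + (s.a₁ - s.c₃) * x * z +
    (s.b₁ + s.c₂) * y * z)

variable {L : Type*} [LieRing L] [LieAlgebra ℝ L]

/-- The basis `e` has the given brackets. -/
structure Brackets.Holds (s : Brackets) (e : Basis (Fin 3) ℝ L) : Prop where
  h12 : ⁅e 0, e 1⁆ = lin e s.a₁ s.a₂ s.a₃
  h13 : ⁅e 0, e 2⁆ = lin e s.b₁ s.b₂ s.b₃
  h32 : ⁅e 2, e 1⁆ = lin e s.c₁ s.c₂ s.c₃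

namespace Brackets.Holds

variable {s : Brackets} {e : Basis (Fin 3) ℝ L}

theorem lie_lin (h : s.Holds e) (p q r p' q' r' : ℝ) : ⁅lin e p q r, lin e p' q' r'⁆ =
    lin e ((p * q' - q * p') * s.a₁ + (p * r' - r * p') * s.b₁ + (r * q' - q * r') * s.c₁)
      ((p * q' - q * p') * s.a₂ + (p * r' - r * p') * s.b₂ + (r * q' - q * r') * s.c₂)
      ((p * q' - q * p') * s.a₃ + (p * r' - r * p') * s.b₃ + (r * q' - q * r') * s.c₃) := by
  have h21 : ⁅e 1, e 0⁆ = -lin e s.a₁ s.a₂ s.a₃ := by rw [← lie_skew, h.h12]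
  have h31 : ⁅e 2, e 0⁆ = -lin e s.b₁ s.b₂ s.b₃ := by rw [← lie_skew, h.h13]
  have h23 : ⁅e 1, e 2⁆ = -lin e s.c₁ s.c₂ s.c₃ := by rw [← lie_skew, h.h32]
  rw [lin, lin]
  simp only [lie_add, add_lie, lie_smul, smul_lie, lie_self, h.h12, h.h13, h.h32, h21, h31, h23]
  simp only [lin]
  module

theorem cobracket_bivec (h : s.Holds e) (x y z p q r : ℝ) :
    cobracket e (bivec e x y z) (lin e p q r) =
      bivec e
        (p * (s.a₂ * x + s.b₂ * y - s.b₁ * z) + q * (-s.a₁ * x - s.c₂ * y + s.c₁ * z) +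
          r * ((s.c₂ - s.b₁) * x))
        (p * (s.a₃ * x + s.b₃ * y + s.a₁ * z) + q * ((-s.a₁ - s.c₃) * y) +
          r * (s.c₃ * x - s.b₁ * y + s.c₁ * z))
        (p * ((s.a₂ + s.b₃) * z) + q * (s.a₃ * x - s.a₂ * y - s.c₃ * z) +
          r * (s.b₃ * x - s.b₂ * y + s.c₂ * z)) := by
  have hb : bivec e x y z = x • wedge (lin e 1 0 0) (lin e 0 1 0) +
      y • wedge (lin e 1 0 0) (lin e 0 0 1) + z • wedge (lin e 0 1 0) (lin e 0 0 1) := by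
    simp only [wedge_lin, bivec_smul, bivec_add]
    congr 1 <;> ring
  rw [hb]
  simp only [cobracket_add, cobracket_smul, LinearMap.add_apply, LinearMap.smul_apply,
    cobracket_wedge]
  simp only [h.lie_lin, wedge_lin, bivec_add, bivec_smul]
  congr 1 <;> ring

theorem schoutenSq_bivec (h : s.Holds e) (x y z : ℝ) :
    schoutenSq e (bivec e x y z) = s.sqCoeff x y z • e123 e := by
  have hb : bivec e x y z = x • wedge (lin e 1 0 0) (lin e 0 1 0) +
      y • wedge (lin e 1 0 0) (lin e 0 0 1) + z • wedge (lin e 0 1 0) (lin e 0 0 1) := by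
    simp only [wedge_lin, bivec_smul, bivec_add]
    congr 1 <;> ring
  rw [hb, schoutenSq]
  simp only [map_add, map_smul, LinearMap.add_apply, LinearMap.smul_apply,
    schouten_wedge_wedge, h.lie_lin, wedge₃_lin, Brackets.sqCoeff]
  module

/-- The Lie algebra acts on its top exterior power by the trace of ad; the coefficient is that
trace, as in `trace_ad_lin`. So Λ³g is invariant exactly in the unimodular case. -/
theorem schouten_e123 (h : s.Holds e) (p q r : ℝ) :
    schouten e 0 2 (vec (lin e p q r)) (e123 e) =
      (p * (s.a₂ + s.b₃) - q * (s.a₁ + s.c₃) + r * (s.c₂ - s.b₁)) • e123 e := by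
  have hb : e123 e = wedge₃ (lin e 1 0 0) (lin e 0 1 0) (lin e 0 0 1) := by
    rw [wedge₃_lin]; module
  have h0 : schouten e 0 2 (vec (lin e p q r)) (e123 e) =
      schouten e 0 2 (vec (lin e p q r)) (wedge₃ (lin e 1 0 0) (lin e 0 1 0) (lin e 0 0 1)) :=
    congrArg _ hb
  rw [h0, schouten_vec_wedge₃]
  simp only [h.lie_lin, wedge₃_lin]
  module

/-- The three groups of equations are the coordinates of δ_r on the three basis vectors. -/
theorem bivec_mem_inv2_iff (h : s.Holds e) (x y z : ℝ) : bivec e x y z ∈ inv2 e ↔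
    (s.a₂ * x + s.b₂ * y - s.b₁ * z = 0 ∧ s.a₃ * x + s.b₃ * y + s.a₁ * z = 0 ∧
      (s.a₂ + s.b₃) * z = 0) ∧
    (-s.a₁ * x - s.c₂ * y + s.c₁ * z = 0 ∧ (-s.a₁ - s.c₃) * y = 0 ∧
      s.a₃ * x - s.a₂ * y - s.c₃ * z = 0) ∧
    ((s.c₂ - s.b₁) * x = 0 ∧ s.c₃ * x - s.b₁ * y + s.c₁ * z = 0 ∧
      s.b₃ * x - s.b₂ * y + s.c₂ * z = 0) := by
  rw [mem_inv2_iff]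
  constructor
  · intro h0
    have h1 := LinearMap.congr_fun h0 (lin e 1 0 0)
    have h2 := LinearMap.congr_fun h0 (lin e 0 1 0)
    have h3 := LinearMap.congr_fun h0 (lin e 0 0 1)
    rw [h.cobracket_bivec, LinearMap.zero_apply, bivec_eq_zero_iff] at h1 h2 h3
    simp only [one_mul, zero_mul, add_zero, zero_add] at h1 h2 h3
    exact ⟨h1, h2, h3⟩
  · rintro ⟨⟨h1, h2, h3⟩, ⟨h4, h5, h6⟩, h7, h8, h9⟩
    ext1 v
    obtain ⟨p, q, r, rfl⟩ := exists_lin e v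
    rw [h.cobracket_bivec, h1, h2, h3, h4, h5, h6, h7, h8, h9, LinearMap.zero_apply,
      bivec_eq_zero_iff]
    simp

theorem smul_e123_mem_inv3_iff (h : s.Holds e) (c : ℝ) : c • e123 e ∈ inv3 e ↔
    c * (s.a₂ + s.b₃) = 0 ∧ c * (s.a₁ + s.c₃) = 0 ∧ c * (s.c₂ - s.b₁) = 0 := by
  have key : ∀ p q r, schouten e 0 2 (vec (lin e p q r)) (c • e123 e) =
      (c * (p * (s.a₂ + s.b₃) - q * (s.a₁ + s.c₃) + r * (s.c₂ - s.b₁))) • e123 e := fun p q r => by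
    refine (map_smul _ c (e123 e)).trans ?_
    rw [h.schouten_e123]
    exact smul_smul _ _ _
  constructor
  · intro h0
    have h1 := (smul_e123_eq_zero_iff e).1 ((key 1 0 0).symm.trans (h0 _))
    have h2 := (smul_e123_eq_zero_iff e).1 ((key 0 1 0).symm.trans (h0 _))
    have h3 := (smul_e123_eq_zero_iff e).1 ((key 0 0 1).symm.trans (h0 _))
    refine ⟨?_, ?_, ?_⟩ <;> linarith
  · rintro ⟨h1, h2, h3⟩ v
    obtain ⟨p, q, r, rfl⟩ := exists_lin e v
    refine (key p q r).trans ((smul_e123_eq_zero_iff e).2 ?_)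
    linear_combination p * h1 - q * h2 + r * h3

end Brackets.Holds

end

/-! ### The Jacobi identity on the dual space -/

section Jacobi

variable {L : Type*} [LieRing L] [LieAlgebra ℝ L]

theorem dualBracket_apply_of_eq_bivec (e : Basis (Fin 3) ℝ L) (δ : L →ₗ[ℝ] ⋀[ℝ]^2 L) (θ η : Dual ℝ L)
    {v : L} {x y z : ℝ} (h : δ v = bivec e x y z) : dualBracket δ θ η v =
      x * (θ (e 0) * η (e 1) - θ (e 1) * η (e 0)) + y * (θ (e 0) * η (e 2) - θ (e 2) * η (e 0)) +
        z * (θ (e 1) * η (e 2) - θ (e 2) * η (e 1)) := by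
  rw [← pairingDual_bivec e, ← h]
  rfl

/-- The Jacobi identity for the transpose of `δ : eₖ ↦ D k 0 e₁₂ + D k 1 e₁₃ + D k 2 e₂₃`. -/
theorem dualBracket_jacobi_iff (e : Basis (Fin 3) ℝ L) (δ : L →ₗ[ℝ] ⋀[ℝ]^2 L)
    (D : Fin 3 → Fin 3 → ℝ) (h : ∀ k, δ (e k) = bivec e (D k 0) (D k 1) (D k 2)) :
    (∀ θ η ζ : Dual ℝ L, dualBracket δ θ (dualBracket δ η ζ) + dualBracket δ η (dualBracket δ ζ θ) +
      dualBracket δ ζ (dualBracket δ θ η) = 0) ↔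
    ∀ k, D k 0 * (D 1 2 + D 0 1) + D k 1 * (D 2 2 - D 0 0) - D k 2 * (D 2 1 + D 1 0) = 0 := by
  have key (θ η : Dual ℝ L) (k : Fin 3) := dualBracket_apply_of_eq_bivec e δ θ η (h k)
  constructor
  · intro hJ k
    have h0 := LinearMap.congr_fun (hJ (e.coord 0) (e.coord 1) (e.coord 2)) (e k)
    simp only [LinearMap.add_apply, key] at h0
    simp at h0
    linear_combination h0
  · intro hD θ η ζ
    refine e.ext fun k => ?_
    simp only [LinearMap.add_apply, LinearMap.zero_apply, key]
    -- The Jacobiator is trilinear and alternating on a space of dimension three, hence det(θ, η, ζ)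
    -- times its value on the dual basis.
    linear_combination (θ (e 0) * (η (e 1) * ζ (e 2) - η (e 2) * ζ (e 1)) -
      θ (e 1) * (η (e 0) * ζ (e 2) - η (e 2) * ζ (e 0)) +
      θ (e 2) * (η (e 0) * ζ (e 1) - η (e 1) * ζ (e 0))) * hD k

/-- Row k of D holds the coordinates of δ_r(eₖ). A coboundary is always a cocycle, so only the
Jacobi identity is a condition on r. -/
theorem Brackets.Holds.isRMatrix_bivec_iff {s : Brackets} {e : Basis (Fin 3) ℝ L} (h : s.Holds e)
    (x y z : ℝ) {D : Fin 3 → Fin 3 → ℝ}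
    (hD : D = ![![s.a₂ * x + s.b₂ * y - s.b₁ * z, s.a₃ * x + s.b₃ * y + s.a₁ * z,
        (s.a₂ + s.b₃) * z],
      ![-s.a₁ * x - s.c₂ * y + s.c₁ * z, (-s.a₁ - s.c₃) * y, s.a₃ * x - s.a₂ * y - s.c₃ * z],
      ![(s.c₂ - s.b₁) * x, s.c₃ * x - s.b₁ * y + s.c₁ * z, s.b₃ * x - s.b₂ * y + s.c₂ * z]]) :
    IsRMatrix e (bivec e x y z) ↔
      ∀ k, D k 0 * (D 1 2 + D 0 1) + D k 1 * (D 2 2 - D 0 0) - D k 2 * (D 2 1 + D 1 0) = 0 := by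
  rw [← dualBracket_jacobi_iff e (cobracket e (bivec e x y z)) D]
  · exact ⟨fun h' => h'.jacobi, fun h' => ⟨cobracket_cocycle e _, h'⟩⟩
  · have h0 := h.cobracket_bivec x y z 1 0 0
    have h1 := h.cobracket_bivec x y z 0 1 0
    have h2 := h.cobracket_bivec x y z 0 0 1
    rw [← basis_zero_eq_lin] at h0
    rw [← basis_one_eq_lin] at h1
    rw [← basis_two_eq_lin] at h2
    intro k
    fin_cases k
    · simpa [hD] using h0
    · simpa [hD] using h1
    · simpa [hD] using h2

end Jacobi

/-! ### Automorphisms as changes of basis that keep the structure constants -/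

section Automorphisms

variable {L : Type*} [LieRing L] [LieAlgebra ℝ L]

theorem exists_basis_lin (e : Basis (Fin 3) ℝ L) {u₁ u₂ u₃ v₁ v₂ v₃ w₁ w₂ w₃ : ℝ}
    (hdet : u₁ * (v₂ * w₃ - v₃ * w₂) - u₂ * (v₁ * w₃ - v₃ * w₁) + u₃ * (v₁ * w₂ - v₂ * w₁) ≠ 0) :
    ∃ f : Basis (Fin 3) ℝ L, f 0 = lin e u₁ u₂ u₃ ∧ f 1 = lin e v₁ v₂ v₃ ∧ f 2 = lin e w₁ w₂ w₃ := by
  have hb := (Basis.is_basis_iff_det e (v := ![lin e u₁ u₂ u₃, lin e v₁ v₂ v₃, lin e w₁ w₂ w₃])).2 (by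
    rw [Basis.det_apply, Matrix.det_fin_three, isUnit_iff_ne_zero]
    simp only [Basis.toMatrix_apply, lin]
    simp
    contrapose! hdet
    linear_combination hdet)
  refine ⟨Basis.mk hb.1 hb.2.ge, ?_, ?_, ?_⟩ <;> simp

/-- If the basis `e` has the brackets `s`, then the vectors `u, v, w`, given by their coordinates,
have the brackets `s'`. -/
def Brackets.ChangesTo (s s' : Brackets) (u₁ u₂ u₃ v₁ v₂ v₃ w₁ w₂ w₃ : ℝ) : Prop :=
  ((u₁ * v₂ - u₂ * v₁) * s.a₁ + (u₁ * v₃ - u₃ * v₁) * s.b₁ + (u₃ * v₂ - u₂ * v₃) * s.c₁ =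
      s'.a₁ * u₁ + s'.a₂ * v₁ + s'.a₃ * w₁ ∧
    (u₁ * v₂ - u₂ * v₁) * s.a₂ + (u₁ * v₃ - u₃ * v₁) * s.b₂ + (u₃ * v₂ - u₂ * v₃) * s.c₂ =
      s'.a₁ * u₂ + s'.a₂ * v₂ + s'.a₃ * w₂ ∧
    (u₁ * v₂ - u₂ * v₁) * s.a₃ + (u₁ * v₃ - u₃ * v₁) * s.b₃ + (u₃ * v₂ - u₂ * v₃) * s.c₃ =
      s'.a₁ * u₃ + s'.a₂ * v₃ + s'.a₃ * w₃) ∧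
  ((u₁ * w₂ - u₂ * w₁) * s.a₁ + (u₁ * w₃ - u₃ * w₁) * s.b₁ + (u₃ * w₂ - u₂ * w₃) * s.c₁ =
      s'.b₁ * u₁ + s'.b₂ * v₁ + s'.b₃ * w₁ ∧
    (u₁ * w₂ - u₂ * w₁) * s.a₂ + (u₁ * w₃ - u₃ * w₁) * s.b₂ + (u₃ * w₂ - u₂ * w₃) * s.c₂ =
      s'.b₁ * u₂ + s'.b₂ * v₂ + s'.b₃ * w₂ ∧
    (u₁ * w₂ - u₂ * w₁) * s.a₃ + (u₁ * w₃ - u₃ * w₁) * s.b₃ + (u₃ * w₂ - u₂ * w₃) * s.c₃ =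
      s'.b₁ * u₃ + s'.b₂ * v₃ + s'.b₃ * w₃) ∧
  ((w₁ * v₂ - w₂ * v₁) * s.a₁ + (w₁ * v₃ - w₃ * v₁) * s.b₁ + (w₃ * v₂ - w₂ * v₃) * s.c₁ =
      s'.c₁ * u₁ + s'.c₂ * v₁ + s'.c₃ * w₁ ∧
    (w₁ * v₂ - w₂ * v₁) * s.a₂ + (w₁ * v₃ - w₃ * v₁) * s.b₂ + (w₃ * v₂ - w₂ * v₃) * s.c₂ =
      s'.c₁ * u₂ + s'.c₂ * v₂ + s'.c₃ * w₂ ∧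
    (w₁ * v₂ - w₂ * v₁) * s.a₃ + (w₁ * v₃ - w₃ * v₁) * s.b₃ + (w₃ * v₂ - w₂ * v₃) * s.c₃ =
      s'.c₁ * u₃ + s'.c₂ * v₃ + s'.c₃ * w₃)

theorem lin_lin (e f : Basis (Fin 3) ℝ L) {u₁ u₂ u₃ v₁ v₂ v₃ w₁ w₂ w₃ : ℝ}
    (hu : f 0 = lin e u₁ u₂ u₃) (hv : f 1 = lin e v₁ v₂ v₃) (hw : f 2 = lin e w₁ w₂ w₃)
    (a b c : ℝ) : lin f a b c =
      lin e (a * u₁ + b * v₁ + c * w₁) (a * u₂ + b * v₂ + c * w₂) (a * u₃ + b * v₃ + c * w₃) := by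
  rw [lin, hu, hv, hw]
  simp only [lin]
  module

theorem bivec_lin (e f : Basis (Fin 3) ℝ L) {u₁ u₂ u₃ v₁ v₂ v₃ w₁ w₂ w₃ : ℝ}
    (hu : f 0 = lin e u₁ u₂ u₃) (hv : f 1 = lin e v₁ v₂ v₃) (hw : f 2 = lin e w₁ w₂ w₃)
    (x y z : ℝ) : bivec f x y z =
      bivec e (x * (u₁ * v₂ - u₂ * v₁) + y * (u₁ * w₂ - u₂ * w₁) + z * (v₁ * w₂ - v₂ * w₁))
        (x * (u₁ * v₃ - u₃ * v₁) + y * (u₁ * w₃ - u₃ * w₁) + z * (v₁ * w₃ - v₃ * w₁))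
        (x * (u₂ * v₃ - u₃ * v₂) + y * (u₂ * w₃ - u₃ * w₂) + z * (v₂ * w₃ - v₃ * w₂)) := by
  change x • wedge (f 0) (f 1) + y • wedge (f 0) (f 2) + z • wedge (f 1) (f 2) = _
  rw [hu, hv, hw]
  simp only [wedge_lin, bivec_smul, bivec_add]

theorem mapTwo_bivec (T : L ≃ₗ⁅ℝ⁆ L) (e f : Basis (Fin 3) ℝ L) (hT : ∀ i, T (e i) = f i)
    (x y z : ℝ) : mapTwo T (bivec e x y z) = bivec f x y z := by
  change mapTwo T (x • wedge (e 0) (e 1) + y • wedge (e 0) (e 2) + z • wedge (e 1) (e 2)) =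
    x • wedge (f 0) (f 1) + y • wedge (f 0) (f 2) + z • wedge (f 1) (f 2)
  simp only [map_add, map_smul, mapTwo_wedge, hT]

namespace Brackets.Holds

variable {s : Brackets} {e : Basis (Fin 3) ℝ L}

theorem holds_iff_changesTo (h : s.Holds e) {s' : Brackets} {f : Basis (Fin 3) ℝ L}
    {u₁ u₂ u₃ v₁ v₂ v₃ w₁ w₂ w₃ : ℝ}
    (hu : f 0 = lin e u₁ u₂ u₃) (hv : f 1 = lin e v₁ v₂ v₃) (hw : f 2 = lin e w₁ w₂ w₃) :
    s'.Holds f ↔ s.ChangesTo s' u₁ u₂ u₃ v₁ v₂ v₃ w₁ w₂ w₃ := by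
  have h1 : s'.Holds f ↔ ⁅f 0, f 1⁆ = lin f s'.a₁ s'.a₂ s'.a₃ ∧ ⁅f 0, f 2⁆ = lin f s'.b₁ s'.b₂ s'.b₃ ∧
      ⁅f 2, f 1⁆ = lin f s'.c₁ s'.c₂ s'.c₃ :=
    ⟨fun h => ⟨h.h12, h.h13, h.h32⟩, fun h => ⟨h.1, h.2.1, h.2.2⟩⟩
  rw [h1, hu, hv, hw, h.lie_lin, h.lie_lin, h.lie_lin, lin_lin e f hu hv hw, lin_lin e f hu hv hw,
    lin_lin e f hu hv hw, lin_inj, lin_inj, lin_inj]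
  rfl

theorem map (h : s.Holds e) {f : Basis (Fin 3) ℝ L} (T : L ≃ₗ⁅ℝ⁆ L) (hT : ∀ i, T (e i) = f i) :
    s.Holds f := by
  have hl : ∀ a b c, T (lin e a b c) = lin f a b c := fun a b c => by
    simp only [lin, map_add, map_smul, hT]
  exact ⟨by rw [← hT, ← hT, ← LieEquiv.map_lie, h.h12, hl],
    by rw [← hT, ← hT, ← LieEquiv.map_lie, h.h13, hl],
    by rw [← hT, ← hT, ← LieEquiv.map_lie, h.h32, hl]⟩

/-- Structure constants determine the bracket, so the linear map between two bases that share them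
is an automorphism. This turns the construction of automorphisms into checking polynomial
identities. -/
theorem exists_lieEquiv (h : s.Holds e) {f : Basis (Fin 3) ℝ L} (h' : s.Holds f) :
    ∃ T : L ≃ₗ⁅ℝ⁆ L, ∀ i, T (e i) = f i := by
  have hT : ∀ i, e.equiv f (Equiv.refl _) (e i) = f i := fun i => by simp
  have hl : ∀ a b c, e.equiv f (Equiv.refl _) (lin e a b c) = lin f a b c := fun a b c => by
    simp only [lin, map_add, map_smul, hT]
  refine ⟨{ e.equiv f (Equiv.refl _) with
    map_lie' := fun {x y} => ?_ }, hT⟩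
  obtain ⟨a, b, c, rfl⟩ := exists_lin e x
  obtain ⟨a', b', c', rfl⟩ := exists_lin e y
  change e.equiv f (Equiv.refl _) ⁅lin e a b c, lin e a' b' c'⁆ =
    ⁅e.equiv f (Equiv.refl _) (lin e a b c), e.equiv f (Equiv.refl _) (lin e a' b' c')⁆
  rw [h.lie_lin, hl, hl, hl, h'.lie_lin]

/-- An automorphism, given by its matrix, makes bivectors equivalent. -/
theorem reducedEquiv (h : s.Holds e) (u₁ u₂ u₃ v₁ v₂ v₃ w₁ w₂ w₃ : ℝ)
    (hdet : u₁ * (v₂ * w₃ - v₃ * w₂) - u₂ * (v₁ * w₃ - v₃ * w₁) + u₃ * (v₁ * w₂ - v₂ * w₁) ≠ 0)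
    (hp : s.ChangesTo s u₁ u₂ u₃ v₁ v₂ v₃ w₁ w₂ w₃) {x y z x' y' z' : ℝ}
    (hx : bivec e
      (x * (u₁ * v₂ - u₂ * v₁) + y * (u₁ * w₂ - u₂ * w₁) + z * (v₁ * w₂ - v₂ * w₁) - x')
      (x * (u₁ * v₃ - u₃ * v₁) + y * (u₁ * w₃ - u₃ * w₁) + z * (v₁ * w₃ - v₃ * w₁) - y')
      (x * (u₂ * v₃ - u₃ * v₂) + y * (u₂ * w₃ - u₃ * w₂) + z * (v₂ * w₃ - v₃ * w₂) - z') ∈ inv2 e) :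
    ReducedEquiv e (bivec e x y z) (bivec e x' y' z') := by
  obtain ⟨f, hu, hv, hw⟩ := exists_basis_lin e hdet
  obtain ⟨T, hT⟩ := h.exists_lieEquiv ((h.holds_iff_changesTo hu hv hw).2 hp)
  refine ⟨T, ?_⟩
  rw [Submodule.mkQ_apply, Submodule.mkQ_apply, Submodule.Quotient.eq, mapTwo_bivec T e f hT,
    bivec_lin e f hu hv hw, bivec_sub]
  exact hx

theorem exists_basis_of_reducedEquiv (h : s.Holds e) {x y z x' y' z' : ℝ}
    (hr : ReducedEquiv e (bivec e x y z) (bivec e x' y' z')) :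
    ∃ f : Basis (Fin 3) ℝ L, s.Holds f ∧ bivec f x y z - bivec e x' y' z' ∈ inv2 e := by
  obtain ⟨T, hT⟩ := hr
  have hTf : ∀ i, T (e i) = e.map T.toLinearEquiv i := fun i => by simp
  refine ⟨_, h.map T hTf, ?_⟩
  rwa [Submodule.mkQ_apply, Submodule.mkQ_apply, Submodule.Quotient.eq,
    mapTwo_bivec T e _ hTf] at hT

theorem trace_ad_lin (h : s.Holds e) (p q r : ℝ) :
    LinearMap.trace ℝ L (LieAlgebra.ad ℝ L (lin e p q r)) =
      p * (s.a₂ + s.b₃) - q * (s.a₁ + s.c₃) + r * (s.c₂ - s.b₁) := by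
  rw [LinearMap.trace_eq_matrix_trace ℝ e, Matrix.trace, Fin.sum_univ_three]
  simp only [Matrix.diag_apply, LinearMap.toMatrix_apply, LieAlgebra.ad_apply]
  rw [basis_zero_eq_lin, basis_one_eq_lin, basis_two_eq_lin, h.lie_lin, h.lie_lin, h.lie_lin]
  simp [lin]
  ring

/-- The last three equations express that tr ad is invariant under automorphisms. In the
non-unimodular rows r₃, r_{3,λ} and r'_{3,λ} they give at once that the third coordinates of the
images of e₁, e₂, e₃ are 0, 0, 1. -/
theorem exists_of_reducedEquiv (h : s.Holds e) {x y z x' y' z' : ℝ}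
    (hr : ReducedEquiv e (bivec e x y z) (bivec e x' y' z')) :
    ∃ u₁ u₂ u₃ v₁ v₂ v₃ w₁ w₂ w₃ : ℝ, s.ChangesTo s u₁ u₂ u₃ v₁ v₂ v₃ w₁ w₂ w₃ ∧
      bivec e
        (x * (u₁ * v₂ - u₂ * v₁) + y * (u₁ * w₂ - u₂ * w₁) + z * (v₁ * w₂ - v₂ * w₁) - x')
        (x * (u₁ * v₃ - u₃ * v₁) + y * (u₁ * w₃ - u₃ * w₁) + z * (v₁ * w₃ - v₃ * w₁) - y')
        (x * (u₂ * v₃ - u₃ * v₂) + y * (u₂ * w₃ - u₃ * w₂) + z * (v₂ * w₃ - v₃ * w₂) - z') ∈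
        inv2 e ∧
      u₁ * (s.a₂ + s.b₃) - u₂ * (s.a₁ + s.c₃) + u₃ * (s.c₂ - s.b₁) = s.a₂ + s.b₃ ∧
      v₁ * (s.a₂ + s.b₃) - v₂ * (s.a₁ + s.c₃) + v₃ * (s.c₂ - s.b₁) = -(s.a₁ + s.c₃) ∧
      w₁ * (s.a₂ + s.b₃) - w₂ * (s.a₁ + s.c₃) + w₃ * (s.c₂ - s.b₁) = s.c₂ - s.b₁ := by
  obtain ⟨f, h', hf⟩ := h.exists_basis_of_reducedEquiv hr
  obtain ⟨u₁, u₂, u₃, hu⟩ := exists_lin e (f 0)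
  obtain ⟨v₁, v₂, v₃, hv⟩ := exists_lin e (f 1)
  obtain ⟨w₁, w₂, w₃, hw⟩ := exists_lin e (f 2)
  rw [bivec_lin e f hu hv hw, bivec_sub] at hf
  refine ⟨u₁, u₂, u₃, v₁, v₂, v₃, w₁, w₂, w₃, (h.holds_iff_changesTo hu hv hw).1 h', hf, ?_, ?_, ?_⟩
  · rw [← h.trace_ad_lin, ← hu, basis_zero_eq_lin, h'.trace_ad_lin]; ring
  · rw [← h.trace_ad_lin, ← hv, basis_one_eq_lin, h'.trace_ad_lin]; ring
  · rw [← h.trace_ad_lin, ← hw, basis_two_eq_lin, h'.trace_ad_lin]; ring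

end Brackets.Holds

end Automorphisms

/-! ### From separated representatives to the classification -/

section Families

variable {L : Type*} [LieRing L] [LieAlgebra ℝ L]

theorem CocommutatorEquiv.ne_zero {δ δ' : L →ₗ[ℝ] ⋀[ℝ]^2 L} (h : CocommutatorEquiv δ δ')
    (hδ : δ ≠ 0) : δ' ≠ 0 := by
  rintro rfl
  obtain ⟨T, hT⟩ := h.symm
  refine hδ (LinearMap.ext fun v => ?_)
  rw [← T.apply_symm_apply v, ← hT, LinearMap.zero_apply, map_zero, LinearMap.zero_apply]

/-- Loci `P i` that cover the r-matrices outside the invariants, whose elements are all equivalent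
to a representative `ρ i`, are the classes, provided that the representatives are inequivalent. -/
theorem classes_of_family {e : Basis (Fin 3) ℝ L} {ι : Type*} (P : ι → ℝ → ℝ → ℝ → Prop)
    (ρ : ι → ⋀[ℝ]^2 L)
    (hmem : ∀ x y z, (∃ i, P i x y z) ↔ IsRMatrix e (bivec e x y z) ∧ bivec e x y z ∉ inv2 e)
    (hρ : ∀ i, ρ i ∈ locus e (P i))
    (htrans : ∀ i x y z, P i x y z → ReducedEquiv e (bivec e x y z) (ρ i))
    (hsep : ∀ i j, ReducedEquiv e (ρ i) (ρ j) → i = j) :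
    nonzeroClasses e = Set.range (fun i => locus e (P i)) ∧
    (∀ r ∈ Set.range ρ, IsRMatrix e r ∧ cobracket e r ≠ 0) ∧
    (∀ δ, IsCoboundary e δ → δ ≠ 0 →
      ∃! r, r ∈ Set.range ρ ∧ CocommutatorEquiv δ (cobracket e r)) := by
  have hmem' : ∀ r, (∃ i, r ∈ locus e (P i)) ↔ IsRMatrix e r ∧ cobracket e r ≠ 0 := by
    intro r
    obtain ⟨x, y, z, rfl⟩ := exists_bivec e r
    simp only [mem_locus_iff, hmem, mem_inv2_iff, ne_eq]
  have htrans' : ∀ i r, r ∈ locus e (P i) → ReducedEquiv e r (ρ i) := by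
    rintro i _ ⟨x, y, z, h, rfl⟩
    exact htrans i x y z h
  have hclass : ∀ i r, r ∈ locus e (P i) → rClass e r = locus e (P i) := by
    intro i r hr
    ext r'
    constructor
    · rintro ⟨h1, h2⟩
      -- Being nonzero passes along the equivalence, so r' lies in some locus; joining the two
      -- representatives through r and r' shows that it is the same locus.
      obtain ⟨j, hj⟩ := (hmem' r').2 ⟨h1, h2.ne_zero ((hmem' r).1 ⟨i, hr⟩).2⟩
      have : i = j := hsep i j <| (htrans' i r hr).symm.trans <|
        ((cocommutatorEquiv_iff e _ _).1 h2).trans (htrans' j r' hj)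
      rwa [this]
    · intro hr'
      exact ⟨((hmem' r').1 ⟨i, hr'⟩).1, (cocommutatorEquiv_iff e _ _).2
        ((htrans' i r hr).trans (htrans' i r' hr').symm)⟩
  refine ⟨?_, ?_, ?_⟩
  · ext C
    constructor
    · rintro ⟨r, h1, h2, rfl⟩
      obtain ⟨i, hi⟩ := (hmem' r).2 ⟨h1, h2⟩
      exact ⟨i, (hclass i r hi).symm⟩
    · rintro ⟨i, rfl⟩
      have := (hmem' (ρ i)).1 ⟨i, hρ i⟩
      exact ⟨ρ i, this.1, this.2, (hclass i _ (hρ i)).symm⟩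
  · rintro _ ⟨i, rfl⟩
    exact (hmem' _).1 ⟨i, hρ i⟩
  · rintro δ ⟨h1, r, rfl⟩ h2
    obtain ⟨i, hi⟩ := (hmem' r).2 ⟨h1, h2⟩
    refine ⟨ρ i, ⟨⟨i, rfl⟩, (cocommutatorEquiv_iff e _ _).2 (htrans' i r hi)⟩, ?_⟩
    rintro _ ⟨⟨j, rfl⟩, hj⟩
    rw [hsep i j ((htrans' i r hi).symm.trans ((cocommutatorEquiv_iff e _ _).1 hj))]

end Families

/-! ### Invariants, mCYBE and r-matrices, row by row -/

section

/-- The structure constants of a row. -/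
def Row.brackets (t : Row) : Brackets :=
  match t with
  | .sl2 => ⟨0, 1, 0, 0, 0, -1, -1, 0, 0⟩
  | .su2 => ⟨0, 0, 1, 0, -1, 0, -1, 0, 0⟩
  | .heis => ⟨0, 0, 1, 0, 0, 0, 0, 0, 0⟩
  | .r30' => ⟨0, 0, -1, 0, 1, 0, 0, 0, 0⟩
  | .r3m1 => ⟨0, 1, 0, 0, 0, -1, 0, 0, 0⟩
  | .r31 => ⟨0, 1, 0, 0, 0, 1, 0, 0, 0⟩
  | .r3 => ⟨0, 0, 0, -1, 0, 0, 1, 1, 0⟩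
  | .r3l l _ => ⟨0, 0, 0, -1, 0, 0, 0, l, 0⟩
  | .r3l' l _ => ⟨0, 0, 0, -l, 1, 0, 1, l, 0⟩

variable {L : Type*} [LieRing L] [LieAlgebra ℝ L]

theorem Row.relations_iff (t : Row) (e : Basis (Fin 3) ℝ L) :
    t.Relations e ↔ t.brackets.Holds e := by
  have h : t.brackets.Holds e ↔ ⁅e 0, e 1⁆ = lin e t.brackets.a₁ t.brackets.a₂ t.brackets.a₃ ∧
      ⁅e 0, e 2⁆ = lin e t.brackets.b₁ t.brackets.b₂ t.brackets.b₃ ∧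
      ⁅e 2, e 1⁆ = lin e t.brackets.c₁ t.brackets.c₂ t.brackets.c₃ :=
    ⟨fun h => ⟨h.h12, h.h13, h.h32⟩, fun h => ⟨h.1, h.2.1, h.2.2⟩⟩
  rw [h]
  cases t <;>
    simp [Row.Relations, Row.brackets, lin, sub_eq_add_neg, add_comm]

theorem Row.sqCoeff_brackets (t : Row) (x y z : ℝ) :
    t.brackets.sqCoeff x y z = t.schoutenCoeff x y z := by
  cases t <;> simp only [Row.brackets, Brackets.sqCoeff, Row.schoutenCoeff] <;> ring

theorem Row.inv2_eq (t : Row) {e : Basis (Fin 3) ℝ L} (h : t.brackets.Holds e) :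
    CoboundaryLie.inv2 e = t.inv2 e := by
  ext r
  obtain ⟨x, y, z, rfl⟩ := exists_bivec e r
  rw [h.bivec_mem_inv2_iff]
  cases t with
  | heis =>
    simp only [Row.brackets, Row.inv2, Submodule.mem_span_pair, e13_eq_bivec, e23_eq_bivec,
      bivec_smul, bivec_add, bivec_inj]
    simp
    exact eq_comm
  | r30' =>
    simp only [Row.brackets, Row.inv2, Submodule.mem_span_singleton, e23_eq_bivec, bivec_smul,
      bivec_inj]
    simp
    grind
  | r3m1 =>
    simp only [Row.brackets, Row.inv2, Submodule.mem_span_singleton, e23_eq_bivec, bivec_smul,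
      bivec_inj]
    simp
    grind
  | r3l l hl =>
    have : l + 1 ≠ 0 := by linarith [hl.1]
    simp only [Row.brackets, Row.inv2, Submodule.mem_bot, bivec_eq_zero_iff]
    simp [this]
    grind
  | r3l' l hl =>
    simp only [Row.brackets, Row.inv2, Submodule.mem_bot, bivec_eq_zero_iff]
    constructor
    · rintro ⟨⟨h1, -, -⟩, ⟨h4, -, -⟩, h7, h8, h9⟩
      have hx : x = 0 := by
        have : (2 * l) * x = 0 := by linarith
        simpa [hl] using this
      have hy : y = 0 := by
        -- The equations ly + z = 0 and -y + lz = 0 form a system of determinant l² + 1.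
        have : (l ^ 2 + 1) * y = 0 := by linear_combination l * h8 - h9
        exact (mul_eq_zero.1 this).resolve_left (by positivity)
      subst hy
      exact ⟨hx, rfl, by linarith⟩
    · rintro ⟨rfl, rfl, rfl⟩
      simp
  | _ =>
    simp only [Row.brackets, Row.inv2, Submodule.mem_bot, bivec_eq_zero_iff]
    grind

/-- The coordinates of the invariant bivectors of a row. -/
def Row.Invariant (t : Row) (x y z : ℝ) : Prop :=
  match t with
  | .heis => x = 0
  | .r30' => x = 0 ∧ y = 0
  | .r3m1 => x = 0 ∧ y = 0
  | _ => x = 0 ∧ y = 0 ∧ z = 0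

theorem Row.bivec_mem_inv2_iff (t : Row) {e : Basis (Fin 3) ℝ L} (h : t.brackets.Holds e)
    (x y z : ℝ) : bivec e x y z ∈ CoboundaryLie.inv2 e ↔ t.Invariant x y z := by
  rw [t.inv2_eq h]
  cases t with
  | heis =>
    simp only [Row.Invariant, Row.inv2, Submodule.mem_span_pair, e13_eq_bivec, e23_eq_bivec,
      bivec_smul, bivec_add, bivec_inj]
    simp [eq_comm]
  | r30' =>
    simp only [Row.Invariant, Row.inv2, Submodule.mem_span_singleton, e23_eq_bivec, bivec_smul,
      bivec_inj]
    simp [eq_comm]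
  | r3m1 =>
    simp only [Row.Invariant, Row.inv2, Submodule.mem_span_singleton, e23_eq_bivec, bivec_smul,
      bivec_inj]
    simp [eq_comm]
  | _ => simp only [Row.Invariant, Row.inv2, Submodule.mem_bot, bivec_eq_zero_iff]

theorem Row.reducedEquiv (t : Row) {e : Basis (Fin 3) ℝ L} (h : t.brackets.Holds e)
    (u₁ u₂ u₃ v₁ v₂ v₃ w₁ w₂ w₃ : ℝ)
    (hdet : u₁ * (v₂ * w₃ - v₃ * w₂) - u₂ * (v₁ * w₃ - v₃ * w₁) + u₃ * (v₁ * w₂ - v₂ * w₁) ≠ 0)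
    (hp : t.brackets.ChangesTo t.brackets u₁ u₂ u₃ v₁ v₂ v₃ w₁ w₂ w₃) {x y z x' y' z' : ℝ}
    (hx : t.Invariant
      (x * (u₁ * v₂ - u₂ * v₁) + y * (u₁ * w₂ - u₂ * w₁) + z * (v₁ * w₂ - v₂ * w₁) - x')
      (x * (u₁ * v₃ - u₃ * v₁) + y * (u₁ * w₃ - u₃ * w₁) + z * (v₁ * w₃ - v₃ * w₁) - y')
      (x * (u₂ * v₃ - u₃ * v₂) + y * (u₂ * w₃ - u₃ * w₂) + z * (v₂ * w₃ - v₃ * w₂) - z')) :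
    ReducedEquiv e (bivec e x y z) (bivec e x' y' z') :=
  h.reducedEquiv u₁ u₂ u₃ v₁ v₂ v₃ w₁ w₂ w₃ hdet hp ((t.bivec_mem_inv2_iff h _ _ _).2 hx)

theorem Row.inv3_eq (t : Row) {e : Basis (Fin 3) ℝ L} (h : t.brackets.Holds e) :
    CoboundaryLie.inv3 e = t.inv3 L := by
  ext w
  obtain ⟨c, rfl⟩ := exists_smul_e123 e w
  rw [h.smul_e123_mem_inv3_iff]
  cases t with
  | r31 =>
    simp only [Row.brackets, Row.inv3, Submodule.mem_bot, smul_e123_eq_zero_iff]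
    norm_num
  | r3 =>
    simp only [Row.brackets, Row.inv3, Submodule.mem_bot, smul_e123_eq_zero_iff]
    norm_num
  | r3l l hl =>
    have : l + 1 ≠ 0 := by linarith [hl.1]
    simp only [Row.brackets, Row.inv3, Submodule.mem_bot, smul_e123_eq_zero_iff]
    simp [this]
  | r3l' l hl =>
    have : l + l ≠ 0 := fun h0 => hl (by linarith)
    simp only [Row.brackets, Row.inv3, Submodule.mem_bot, smul_e123_eq_zero_iff]
    simp [this]
  | _ => simp [Row.brackets, Row.inv3]

theorem Row.mcybe_iff (t : Row) {e : Basis (Fin 3) ℝ L} (h : t.brackets.Holds e) (x y z : ℝ) :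
    MCYBE e (bivec e x y z) ↔ t.YB x y z := by
  rw [MCYBE, h.schoutenSq_bivec, h.smul_e123_mem_inv3_iff, t.sqCoeff_brackets]
  cases t with
  | r3 => simp [Row.brackets, Row.schoutenCoeff, Row.YB]
  | r3l l hl =>
    have h1 : l + 1 ≠ 0 := by linarith [hl.1]
    have h2 : l - 1 ≠ 0 := by linarith [hl.2]
    simp [Row.brackets, Row.schoutenCoeff, Row.YB, h1, h2]
  | r3l' l hl =>
    have h1 : l + l ≠ 0 := fun h0 => hl (by linarith)
    simp [Row.brackets, Row.schoutenCoeff, Row.YB, h1]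
    constructor
    · intro h; constructor <;> nlinarith
    · rintro ⟨rfl, rfl⟩; simp
  | _ => simp [Row.brackets, Row.schoutenCoeff, Row.YB]

/-- This is independent of `mcybe_iff`: the dual Jacobi identity is evaluated directly and found to
define the same locus as the mCYBE. -/
theorem Row.isRMatrix_iff (t : Row) {e : Basis (Fin 3) ℝ L} (h : t.brackets.Holds e) (x y z : ℝ) :
    IsRMatrix e (bivec e x y z) ↔ t.YB x y z := by
  rw [h.isRMatrix_bivec_iff x y z rfl, Fin.forall_fin_succ, Fin.forall_fin_two]
  cases t with
  | r3 =>
    simp [Row.brackets, Row.YB]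
    grind
  | r3l l hl =>
    have h1 : l + 1 ≠ 0 := by linarith [hl.1]
    have h2 : l - 1 ≠ 0 := by linarith [hl.2]
    simp [Row.brackets, Row.YB]
    grind
  | r3l' l hl =>
    simp [Row.brackets, Row.YB]
    constructor
    · intro h1
      have h4 : l * (y ^ 2 + z ^ 2) = 0 := by linear_combination (-1 / 2) * h1
      have h5 := (mul_eq_zero.1 h4).resolve_left hl
      constructor <;> nlinarith
    · rintro ⟨rfl, rfl⟩; simp
  | sl2 =>
    simp [Row.brackets, Row.YB]
    refine ⟨?_, ?_, ?_⟩ <;> ring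
  | su2 =>
    simp [Row.brackets, Row.YB]
    refine ⟨?_, ?_, ?_⟩ <;> ring
  | heis => simp [Row.brackets, Row.YB]
  | r30' =>
    simp [Row.brackets, Row.YB]
    ring
  | r3m1 =>
    simp [Row.brackets, Row.YB]
    ring
  | r31 => simp [Row.brackets, Row.YB]

end

/-! ### Classification in the solvable rows -/

section

variable {L : Type*} [LieRing L] [LieAlgebra ℝ L]

/-- The classes of r-matrices with nonzero cocommutator are those of the row, and its
representatives classify the nonzero coboundary cocommutators. -/
structure Row.Classified (t : Row) (e : Basis (Fin 3) ℝ L) : Prop where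
  classes_eq : nonzeroClasses e = t.classes e
  reps_ne_zero : ∀ r ∈ t.reps e, IsRMatrix e r ∧ cobracket e r ≠ 0
  existsUnique_rep : ∀ δ, IsCoboundary e δ → δ ≠ 0 →
    ∃! r, r ∈ t.reps e ∧ CocommutatorEquiv δ (cobracket e r)

theorem Row.classified_of_family (t : Row) {e : Basis (Fin 3) ℝ L} (h : t.brackets.Holds e)
    {ι : Type*} (P : ι → ℝ → ℝ → ℝ → Prop) (X Y Z : ι → ℝ)
    (hC : t.classes e = Set.range fun i => locus e (P i))
    (hR : t.reps e = Set.range fun i => bivec e (X i) (Y i) (Z i))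
    (hmem : ∀ x y z, (∃ i, P i x y z) ↔ t.YB x y z ∧ ¬ t.Invariant x y z)
    (hP : ∀ i, P i (X i) (Y i) (Z i))
    (htrans : ∀ i x y z, P i x y z → ReducedEquiv e (bivec e x y z) (bivec e (X i) (Y i) (Z i)))
    (hsep : ∀ i j, ReducedEquiv e (bivec e (X i) (Y i) (Z i)) (bivec e (X j) (Y j) (Z j)) →
      i = j) : t.Classified e := by
  obtain ⟨h1, h2, h3⟩ := classes_of_family P (fun i => bivec e (X i) (Y i) (Z i))
    (fun x y z => by rw [hmem, t.isRMatrix_iff h, t.bivec_mem_inv2_iff h])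
    (fun i => (mem_locus_iff e _ _ _ _).2 (hP i)) htrans hsep
  rw [← hC] at h1
  rw [← hR] at h2
  exact ⟨h1, h2, fun δ hδ h0 => by simpa only [hR] using h3 δ hδ h0⟩

theorem classified_heis {e : Basis (Fin 3) ℝ L} (h : Row.heis.brackets.Holds e) :
    Row.heis.Classified e := by
  refine Row.heis.classified_of_family h (ι := Unit) (fun _ x _ _ => x ≠ 0) (fun _ => 1) (fun _ => 0)
    (fun _ => 0) ?_ ?_ ?_ ?_ ?_ ?_
  · simp [Row.classes]
  · simp [Row.reps, e12_eq_bivec]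
  · simp [Row.YB, Row.Invariant]
  · simp
  · intro _ x y z hx
    refine Row.heis.reducedEquiv h x⁻¹ 0 0 0 1 0 0 0 x⁻¹ (by simpa using hx) ?_ ?_
    · simp [Row.brackets, Brackets.ChangesTo]
    · simp [Row.Invariant, hx]
  · simp

theorem classified_r30' {e : Basis (Fin 3) ℝ L} (h : Row.r30'.brackets.Holds e) :
    Row.r30'.Classified e := by
  refine Row.r30'.classified_of_family h (ι := Unit) (fun _ x y _ => 0 < x ^ 2 + y ^ 2)
    (fun _ => 1) (fun _ => 0) (fun _ => 0) ?_ ?_ ?_ ?_ ?_ ?_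
  · simp [Row.classes]
  · simp [Row.reps, e12_eq_bivec]
  · intro x y z
    simp only [Row.YB, Row.Invariant, exists_const, true_and]
    constructor
    · rintro h ⟨rfl, rfl⟩; simp at h
    · intro h
      by_contra h'
      exact h ⟨by nlinarith, by nlinarith⟩
  · simp
  · intro _ x y z hn
    have hn' := hn.ne'
    -- Rotations with dilation of ⟨e₂, e₃⟩ commute with ad e₁. This one sends x e₂ + y e₃ to e₂.
    refine Row.r30'.reducedEquiv h 1 0 0 0 (x / (x ^ 2 + y ^ 2)) (-y / (x ^ 2 + y ^ 2))
      0 (y / (x ^ 2 + y ^ 2)) (x / (x ^ 2 + y ^ 2)) ?_ ?_ ?_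
    · have : 1 / (x ^ 2 + y ^ 2) ≠ 0 := by positivity
      convert this using 1
      field_simp
      ring
    · simp [Row.brackets, Brackets.ChangesTo]
      constructor <;> ring
    · simp only [Row.Invariant]
      constructor
      · field_simp
        ring
      · field_simp
        ring
  · simp

theorem classified_r3m1 {e : Basis (Fin 3) ℝ L} (h : Row.r3m1.brackets.Holds e) :
    Row.r3m1.Classified e := by
  -- Automorphisms preserve or interchange the two eigenlines ⟨e₂⟩, ⟨e₃⟩ of ad e₁ in the derived
  -- algebra, so modulo e₂₃ the condition xy = 0 is invariant.
  have hs : ¬ ReducedEquiv e (bivec e 1 0 0) (bivec e 1 (-1) 0) := by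
    intro hr
    obtain ⟨u₁, u₂, u₃, v₁, v₂, v₃, w₁, w₂, w₃, hp, hi, -⟩ := h.exists_of_reducedEquiv hr
    rw [Row.bivec_mem_inv2_iff _ h] at hi
    simp only [Row.brackets, Brackets.ChangesTo, Row.Invariant] at hp hi
    grind
  refine Row.r3m1.classified_of_family h (ι := Fin 2)
    ![fun x y _ => x * y = 0 ∧ x ^ 2 + y ^ 2 ≠ 0, fun x y _ => x * y ≠ 0]
    ![1, 1] ![0, -1] ![0, 0] ?_ ?_ ?_ ?_ ?_ ?_
  · ext C
    simp [Row.classes, eq_comm]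
  · ext r
    simp [Row.reps, e12_eq_bivec, e13_eq_bivec, bivec_sub, eq_comm]
  · intro x y z
    simp [Row.YB, Row.Invariant]
    constructor
    · rintro (⟨h1, h2⟩ | h) h' rfl <;> simp_all
    · intro h
      by_cases hx : x = 0
      · simp_all
      · by_cases hy : y = 0 <;> simp_all
  · simp [Fin.forall_fin_two]
  · rw [Fin.forall_fin_two]
    constructor
    · rintro x y z ⟨h0, h1⟩
      by_cases hx : x = 0
      · have hy : y ≠ 0 := by rintro rfl; simp [hx] at h1
        refine Row.r3m1.reducedEquiv h (-1) 0 0 0 0 1 0 (-y⁻¹) 0 ?_ ?_ ?_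
        · simp [hy]
        · simp [Row.brackets, Brackets.ChangesTo]
        · simp [Row.Invariant, hy, hx]
      · have hy : y = 0 := (mul_eq_zero.1 h0).resolve_left hx
        refine Row.r3m1.reducedEquiv h 1 0 0 0 x⁻¹ 0 0 0 1 ?_ ?_ ?_
        · simp [hx]
        · simp [Row.brackets, Brackets.ChangesTo]
        · simp [Row.Invariant, hy, hx]
    · intro x y z h0
      obtain ⟨hx, hy⟩ := mul_ne_zero_iff.1 h0
      refine Row.r3m1.reducedEquiv h 1 0 0 0 x⁻¹ 0 0 0 (-y⁻¹) ?_ ?_ ?_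
      · simp [hx, hy]
      · simp [Row.brackets, Brackets.ChangesTo]
      · simp [Row.Invariant, hy, hx]
  · intro i j hij
    fin_cases i <;> fin_cases j <;> first | rfl | exact absurd hij hs | exact absurd hij.symm hs

theorem classified_r31 {e : Basis (Fin 3) ℝ L} (h : Row.r31.brackets.Holds e) :
    Row.r31.Classified e := by
  -- The line through e₂₃ is Λ² of the derived algebra, which automorphisms preserve.
  have hs : ¬ ReducedEquiv e (bivec e 0 1 0) (bivec e 0 0 1) := by
    intro hr
    obtain ⟨u₁, u₂, u₃, v₁, v₂, v₃, w₁, w₂, w₃, hp, hi, -⟩ := h.exists_of_reducedEquiv hr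
    rw [Row.bivec_mem_inv2_iff _ h] at hi
    simp only [Row.brackets, Brackets.ChangesTo, Row.Invariant] at hp hi
    grind
  refine Row.r31.classified_of_family h (ι := Fin 2)
    ![fun x y _ => x ^ 2 + y ^ 2 ≠ 0, fun x y z => x = 0 ∧ y = 0 ∧ z ≠ 0]
    ![0, 0] ![1, 0] ![0, 1] ?_ ?_ ?_ ?_ ?_ ?_
  · ext C
    simp [Row.classes, eq_comm]
  · ext r
    simp [Row.reps, e23_eq_bivec, e13_eq_bivec, eq_comm]
  · intro x y z
    simp [Row.YB, Row.Invariant]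
    constructor
    · rintro (h1 | ⟨h1, h2, h3⟩) rfl rfl <;> simp_all
    · intro h'
      by_cases hx : x ^ 2 + y ^ 2 = 0
      · have h1 : x = 0 := by nlinarith
        have h2 : y = 0 := by nlinarith
        exact Or.inr ⟨h1, h2, h' h1 h2⟩
      · exact Or.inl hx
  · simp [Fin.forall_fin_two]
  · rw [Fin.forall_fin_two]
    constructor
    · intro x y z hn
      change x ^ 2 + y ^ 2 ≠ 0 at hn
      -- Any linear map of ⟨e₂, e₃⟩ is compatible with the bracket. Here x e₂ + y e₃ goes to e₃ and
      -- e₂₃ to -e₂₃, while e₁ ↦ e₁ + z e₂ contributes z e₂₃, which cancels the rest.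
      refine Row.r31.reducedEquiv h 1 z 0 0 (-y) (x / (x ^ 2 + y ^ 2)) 0 x (y / (x ^ 2 + y ^ 2))
        ?_ ?_ ?_
      · have : (-1 : ℝ) ≠ 0 := by norm_num
        convert this using 1
        field_simp
        ring
      · simp [Row.brackets, Brackets.ChangesTo]
      · simp only [Row.Invariant, Matrix.cons_val_zero]
        refine ⟨by ring, ?_, ?_⟩
        · field_simp
          ring
        · field_simp
          ring
    · rintro x y z ⟨rfl, rfl, hz⟩
      refine Row.r31.reducedEquiv h 1 0 0 0 z⁻¹ 0 0 0 1 ?_ ?_ ?_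
      · simp [hz]
      · simp [Row.brackets, Brackets.ChangesTo]
      · simp [Row.Invariant, hz]
  · intro i j hij
    fin_cases i <;> fin_cases j <;> first | rfl | exact absurd hij hs | exact absurd hij.symm hs

theorem exists_pos_mul_sq_eq_one {x : ℝ} (hx : 0 < x) : ∃ a : ℝ, a ≠ 0 ∧ x * (a * a) = 1 := by
  have := Real.sqrt_pos.2 hx
  refine ⟨(√x)⁻¹, by positivity, ?_⟩
  rw [← mul_inv, Real.mul_self_sqrt hx.le, mul_inv_cancel₀ hx.ne']

theorem classified_r3 {e : Basis (Fin 3) ℝ L} (h : Row.r3.brackets.Holds e) :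
    Row.r3.Classified e := by
  -- An automorphism commutes with the Jordan block of ad e₃ on ⟨e₁, e₂⟩, so both diagonal entries
  -- agree and e₁₂ is multiplied by a square: the line through e₁₂ and the sign on it are invariant.
  have key : ∀ {x x' y' z' : ℝ}, x ≠ 0 → ReducedEquiv e (bivec e x 0 0) (bivec e x' y' z') →
      y' = 0 ∧ 0 ≤ x * x' := by
    intro x x' y' z' hx hr
    obtain ⟨u₁, u₂, u₃, v₁, v₂, v₃, w₁, w₂, w₃, hp, hi, ht⟩ := h.exists_of_reducedEquiv hr
    rw [Row.bivec_mem_inv2_iff _ h] at hi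
    simp only [Row.brackets, Brackets.ChangesTo, Row.Invariant] at hp hi ht
    have hu : u₃ = 0 := by linarith
    have hv : v₃ = 0 := by linarith
    have hw : w₃ = 1 := by linarith
    subst hu hv hw
    have hv2 : v₂ = u₁ := by linarith
    have hu2 : u₂ = 0 := by linarith
    subst hv2 hu2
    refine ⟨by linarith, ?_⟩
    have : x' = x * v₂ ^ 2 := by linarith
    rw [this]
    nlinarith [mul_self_nonneg (x * v₂)]
  refine Row.r3.classified_of_family h (ι := Fin 3)
    ![fun x y z => 0 < x ∧ y = 0 ∧ z = 0, fun x y z => x < 0 ∧ y = 0 ∧ z = 0,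
      fun _ y z => y ≠ 0 ∧ z = 0]
    ![1, -1, 0] ![0, 0, 1] ![0, 0, 0] ?_ ?_ ?_ ?_ ?_ ?_
  · ext C
    simp [Row.classes, Fin.exists_fin_succ, eq_comm]
  · ext r
    simp [Row.reps, e12_eq_bivec, e13_eq_bivec, neg_bivec, Fin.exists_fin_succ, eq_comm]
  · intro x y z
    simp [Row.YB, Row.Invariant, Fin.exists_fin_succ]
    grind
  · simp [Fin.forall_fin_succ]
  · rw [Fin.forall_fin_succ, Fin.forall_fin_two]
    refine ⟨?_, ?_, ?_⟩
    · rintro x y z ⟨hx, rfl, rfl⟩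
      obtain ⟨a, ha, hxa⟩ := exists_pos_mul_sq_eq_one hx
      refine Row.r3.reducedEquiv h a 0 0 0 a 0 0 0 1 ?_ ?_ ?_
      · simp [ha]
      · simp [Row.brackets, Brackets.ChangesTo]
      · simp [Row.Invariant, hxa]
    · rintro x y z ⟨hx, rfl, rfl⟩
      obtain ⟨a, ha, hxa⟩ := exists_pos_mul_sq_eq_one (neg_pos.2 hx)
      refine Row.r3.reducedEquiv h a 0 0 0 a 0 0 0 1 ?_ ?_ ?_
      · simp [ha]
      · simp [Row.brackets, Brackets.ChangesTo]
      · simp [Row.Invariant]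
        linarith
    · rintro x y z ⟨hy, rfl⟩
      -- The multiple of e₂ added to e₃ cancels the e₁₂ term.
      refine Row.r3.reducedEquiv h y⁻¹ 0 0 0 y⁻¹ 0 0 (-x / y ^ 2) 1 ?_ ?_ ?_
      · simp [hy]
      · simp [Row.brackets, Brackets.ChangesTo]
      · simp [Row.Invariant, hy]
        field_simp
        ring
  · intro i j hij
    fin_cases i <;> fin_cases j <;> try rfl
    · have := (key one_ne_zero hij).2; norm_num at this
    · have := (key one_ne_zero hij).1; norm_num at this
    · have := (key one_ne_zero hij.symm).2; norm_num at this
    · have := (key (by norm_num) hij).1; norm_num at this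
    · have := (key one_ne_zero hij.symm).1; norm_num at this
    · have := (key (by norm_num) hij.symm).1; norm_num at this

theorem classified_r3l (l : ℝ) (hl : -1 < l ∧ l < 1) {e : Basis (Fin 3) ℝ L}
    (h : (Row.r3l l hl).brackets.Holds e) : (Row.r3l l hl).Classified e := by
  have hl1 : l + 1 ≠ 0 := by linarith [hl.1]
  have hl2 : l ≠ 1 := hl.2.ne
  -- On ⟨e₁, e₂⟩ the eigenvalues 1 and l of ad e₃ differ, so each eigenline is preserved.
  -- Consequently y and z are only rescaled, and their vanishing separates the three
  -- representatives.
  have aut : ∀ {u₁ u₂ u₃ v₁ v₂ v₃ w₁ w₂ w₃ : ℝ},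
      (Row.r3l l hl).brackets.ChangesTo (Row.r3l l hl).brackets u₁ u₂ u₃ v₁ v₂ v₃ w₁ w₂ w₃ →
      u₃ * (l + 1) = 0 → v₃ * (l + 1) = 0 → w₃ * (l + 1) = l + 1 →
      u₂ = 0 ∧ u₃ = 0 ∧ v₁ = 0 ∧ v₃ = 0 ∧ w₃ = 1 := by
    intro u₁ u₂ u₃ v₁ v₂ v₃ w₁ w₂ w₃ hp hu hv hw
    simp only [Row.brackets, Brackets.ChangesTo] at hp
    have hu := (mul_eq_zero.1 hu).resolve_right hl1
    have hv := (mul_eq_zero.1 hv).resolve_right hl1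
    have hw := (mul_eq_right₀ hl1).1 hw
    subst hu hv hw
    obtain ⟨-, ⟨-, h1, -⟩, h2, -⟩ := hp
    have h3 : (l - 1) * u₂ = 0 := by linarith
    have h4 : (l - 1) * v₁ = 0 := by linarith
    exact ⟨(mul_eq_zero.1 h3).resolve_left (sub_ne_zero.2 hl2), rfl,
      (mul_eq_zero.1 h4).resolve_left (sub_ne_zero.2 hl2), rfl, rfl⟩
  have key : ∀ {x y z x' y' z' : ℝ}, ReducedEquiv e (bivec e x y z) (bivec e x' y' z') →
      (y = 0 → y' = 0) ∧ (z = 0 → z' = 0) := by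
    intro x y z x' y' z' hr
    obtain ⟨u₁, u₂, u₃, v₁, v₂, v₃, w₁, w₂, w₃, hp, hi, ht⟩ := h.exists_of_reducedEquiv hr
    rw [Row.bivec_mem_inv2_iff _ h] at hi
    obtain ⟨rfl, rfl, rfl, rfl, rfl⟩ := aut hp (by simpa [Row.brackets] using ht.1)
      (by simpa [Row.brackets] using ht.2.1) (by simpa [Row.brackets] using ht.2.2)
    simp only [Row.Invariant] at hi
    constructor
    · rintro rfl; linarith [hi.2.1]
    · rintro rfl; linarith [hi.2.2]
  refine (Row.r3l l hl).classified_of_family h (ι := Fin 3)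
    ![fun _ y z => y = 0 ∧ z ≠ 0, fun _ y z => z = 0 ∧ y ≠ 0, fun x y z => y = 0 ∧ z = 0 ∧ x ≠ 0]
    ![0, 0, 1] ![0, 1, 0] ![1, 0, 0] ?_ ?_ ?_ ?_ ?_ ?_
  · ext C
    simp [Row.classes, Fin.exists_fin_succ, eq_comm]
  · ext r
    simp [Row.reps, e12_eq_bivec, e13_eq_bivec, e23_eq_bivec, Fin.exists_fin_succ, eq_comm]
    tauto
  · intro x y z
    simp [Row.YB, Row.Invariant, Fin.exists_fin_succ]
    tauto
  · simp [Fin.forall_fin_succ]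
  · rw [Fin.forall_fin_succ, Fin.forall_fin_two]
    refine ⟨?_, ?_, ?_⟩
    · rintro x y z ⟨rfl, hz⟩
      refine (Row.r3l l hl).reducedEquiv h 1 0 0 0 z⁻¹ 0 (x / z) 0 1 ?_ ?_ ?_
      · simp [hz]
      · simp [Row.brackets, Brackets.ChangesTo, mul_comm]
      · simp [Row.Invariant, hz]
        field_simp
        ring
    · rintro x y z ⟨rfl, hy⟩
      refine (Row.r3l l hl).reducedEquiv h y⁻¹ 0 0 0 1 0 0 (-x / y) 1 ?_ ?_ ?_
      · simp [hy]
      · simp [Row.brackets, Brackets.ChangesTo, mul_comm]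
      · simp [Row.Invariant, hy]
        field_simp
        ring
    · rintro x y z ⟨rfl, rfl, hx⟩
      refine (Row.r3l l hl).reducedEquiv h x⁻¹ 0 0 0 1 0 0 0 1 ?_ ?_ ?_
      · simp [hx]
      · simp [Row.brackets, Brackets.ChangesTo, mul_comm]
      · simp [Row.Invariant, hx]
  · intro i j hij
    have h1 := key hij
    have h2 := key hij.symm
    fin_cases i <;> fin_cases j <;> first | rfl | (exfalso; simp at h1 h2)

theorem classified_r3l' (l : ℝ) (hl : l ≠ 0) {e : Basis (Fin 3) ℝ L}
    (h : (Row.r3l' l hl).brackets.Holds e) : (Row.r3l' l hl).Classified e := by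
  have hs : ¬ ReducedEquiv e (bivec e 1 0 0) (bivec e (-1) 0 0) := by
    intro hr
    obtain ⟨u₁, u₂, u₃, v₁, v₂, v₃, w₁, w₂, w₃, hp, hi, ht⟩ := h.exists_of_reducedEquiv hr
    rw [Row.bivec_mem_inv2_iff _ h] at hi
    simp only [Row.brackets, Brackets.ChangesTo, Row.Invariant] at hp hi ht
    have hll : l - -l ≠ 0 := fun h0 => hl (by linarith)
    have hu : u₃ = 0 := (mul_eq_zero.1 (by linarith : u₃ * (l - -l) = 0)).resolve_right hll
    have hv : v₃ = 0 := (mul_eq_zero.1 (by linarith : v₃ * (l - -l) = 0)).resolve_right hll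
    have hw : w₃ = 1 := (mul_eq_right₀ hll).1 (by linarith : w₃ * (l - -l) = l - -l)
    subst hu hv hw
    have h1 : v₂ = u₁ := by linarith
    have h2 : v₁ = -u₂ := by linarith
    subst h1 h2
    -- An automorphism acts on ⟨e₁, e₂⟩ as multiplication by a complex number, so it scales e₁₂ by
    -- u₂² + v₂² and cannot reverse its sign.
    linarith [hi.1, mul_self_nonneg u₂, mul_self_nonneg v₂]
  refine (Row.r3l' l hl).classified_of_family h (ι := Fin 2)
    ![fun x y z => 0 < x ∧ y = 0 ∧ z = 0, fun x y z => x < 0 ∧ y = 0 ∧ z = 0]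
    ![1, -1] ![0, 0] ![0, 0] ?_ ?_ ?_ ?_ ?_ ?_
  · ext C
    simp [Row.classes, eq_comm]
  · ext r
    simp [Row.reps, e12_eq_bivec, neg_bivec, eq_comm]
  · intro x y z
    simp [Row.YB, Row.Invariant]
    grind
  · simp [Fin.forall_fin_two]
  · rw [Fin.forall_fin_two]
    constructor
    · rintro x y z ⟨hx, rfl, rfl⟩
      obtain ⟨a, ha, hxa⟩ := exists_pos_mul_sq_eq_one hx
      refine (Row.r3l' l hl).reducedEquiv h a 0 0 0 a 0 0 0 1 ?_ ?_ ?_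
      · simp [ha]
      · simp [Row.brackets, Brackets.ChangesTo, mul_comm]
      · simp [Row.Invariant, hxa]
    · rintro x y z ⟨hx, rfl, rfl⟩
      obtain ⟨a, ha, hxa⟩ := exists_pos_mul_sq_eq_one (neg_pos.2 hx)
      refine (Row.r3l' l hl).reducedEquiv h a 0 0 0 a 0 0 0 1 ?_ ?_ ?_
      · simp [ha]
      · simp [Row.brackets, Brackets.ChangesTo, mul_comm]
      · simp [Row.Invariant]
        linarith
  · intro i j hij
    fin_cases i <;> fin_cases j <;> first | rfl | exact absurd hij hs | exact absurd hij.symm hs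

end

/-! ### Classification for su₂ and sl₂ -/

section

variable {L : Type*} [LieRing L] [LieAlgebra ℝ L]

/-- Rotations are automorphisms: one in the plane ⟨e₂, e₃⟩ removes y, then one in ⟨e₁, e₃⟩ removes
z. -/
theorem reducedEquiv_su2 {e : Basis (Fin 3) ℝ L} (h : Row.su2.brackets.Holds e) {x y z a : ℝ}
    (ha : 0 < a) (hr : x ^ 2 + y ^ 2 + z ^ 2 = a ^ 2) :
    ReducedEquiv e (bivec e x y z) (bivec e a 0 0) := by
  have h1 : ∃ n, n ^ 2 = x ^ 2 + y ^ 2 ∧ ReducedEquiv e (bivec e x y z) (bivec e n 0 z) := by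
    have hn := Real.sq_sqrt (add_nonneg (sq_nonneg x) (sq_nonneg y))
    set n := √(x ^ 2 + y ^ 2)
    refine ⟨n, hn, ?_⟩
    by_cases h0 : n = 0
    · rw [h0] at hn
      have hx : x = 0 := by nlinarith
      have hy : y = 0 := by nlinarith
      rw [h0, hx, hy]
      exact ⟨LieEquiv.refl, by rw [mapTwo_refl]⟩
    · have hcs : x / n * (x / n) + y / n * (y / n) = 1 := by
        field_simp
        linarith
      refine Row.su2.reducedEquiv h 1 0 0 0 (x / n) (-(y / n)) 0 (y / n) (x / n) ?_ ?_ ?_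
      · have : (1 : ℝ) ≠ 0 := one_ne_zero
        convert this using 1
        linear_combination hcs
      · simp [Row.brackets, Brackets.ChangesTo]
        linarith
      · simp only [Row.Invariant]
        refine ⟨?_, ?_, ?_⟩
        · field_simp
          linarith
        · ring
        · linear_combination z * hcs
  obtain ⟨n, hn, h1⟩ := h1
  have hcs : n / a * (n / a) + z / a * (z / a) = 1 := by
    field_simp
    linarith
  refine h1.trans (Row.su2.reducedEquiv h (n / a) 0 (z / a) 0 1 0 (-(z / a)) 0 (n / a) ?_ ?_ ?_)
  · have : (1 : ℝ) ≠ 0 := one_ne_zero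
    convert this using 1
    linear_combination hcs
  · simp [Row.brackets, Brackets.ChangesTo]
    linarith
  · simp only [Row.Invariant]
    refine ⟨?_, ?_, ?_⟩
    · field_simp
      linarith
    · ring
    · ring

theorem classified_su2 {e : Basis (Fin 3) ℝ L} (h : Row.su2.brackets.Holds e) :
    Row.su2.Classified e := by
  refine Row.su2.classified_of_family h (ι := {a : ℝ // 0 < a})
    (fun a x y z => x ^ 2 + y ^ 2 + z ^ 2 = a.1 ^ 2) (fun a => a.1) (fun _ => 0) (fun _ => 0)
    ?_ ?_ ?_ ?_ ?_ ?_
  · ext C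
    simp only [Row.classes, Set.mem_ofPred_eq, Set.mem_range, Subtype.exists]
    constructor
    · rintro ⟨k, hk, rfl⟩
      exact ⟨√k, Real.sqrt_pos.2 hk, by simp only [Real.sq_sqrt hk.le]⟩
    · rintro ⟨a, ha, rfl⟩
      exact ⟨a ^ 2, by positivity, rfl⟩
  · ext r
    simp [Row.reps, e12_eq_bivec, bivec_smul, eq_comm]
  · intro x y z
    simp only [Row.YB, Row.Invariant, Subtype.exists, true_and]
    constructor
    · rintro ⟨a, ha, h1⟩ ⟨rfl, rfl, rfl⟩
      nlinarith
    · intro h1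
      have h2 : 0 < x ^ 2 + y ^ 2 + z ^ 2 := by
        by_contra h0
        exact h1 ⟨by nlinarith, by nlinarith, by nlinarith⟩
      exact ⟨√(x ^ 2 + y ^ 2 + z ^ 2), Real.sqrt_pos.2 h2, (Real.sq_sqrt h2.le).symm⟩
  · intro a
    ring
  · intro a x y z hr
    exact reducedEquiv_su2 h a.2 hr
  · rintro ⟨a, ha⟩ ⟨b, hb⟩ hr
    obtain ⟨u₁, u₂, u₃, v₁, v₂, v₃, w₁, w₂, w₃, hp, hi, -⟩ := h.exists_of_reducedEquiv hr
    rw [Row.bivec_mem_inv2_iff _ h] at hi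
    simp only [Row.brackets, Brackets.ChangesTo, Row.Invariant] at hp hi
    obtain ⟨⟨h1, h2, h3⟩, ⟨h4, h5, h6⟩, h7, h8, h9⟩ := hp
    -- The bracket map sends e₁₂ to e₃, so the hypothesis becomes a T(e₃) = b e₃. The remaining
    -- equations force the ratio w₃ = b/a to have square 1.
    have hw3 : a * w₃ = b := by linear_combination hi.1 - a * h3
    have hw2 : w₂ = 0 := (mul_eq_zero.1 (by linear_combination -hi.2.1 - a * h2 :
      a * w₂ = 0)).resolve_left ha.ne'
    have hw1 : w₁ = 0 := (mul_eq_zero.1 (by linear_combination hi.2.2 - a * h1 :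
      a * w₁ = 0)).resolve_left ha.ne'
    subst hw1 hw2
    have hw0 : 0 < w₃ := by
      by_contra h0
      nlinarith
    have e1 : v₂ = u₁ * w₃ := by linarith
    have e2 : u₁ = w₃ * v₂ := by linarith
    have e3 : v₁ = -u₂ * w₃ := by linarith
    have e4 : u₂ = -w₃ * v₁ := by linarith
    have hw : w₃ ^ 2 = 1 := by
      by_contra h0
      have h0' : w₃ ^ 2 - 1 ≠ 0 := sub_ne_zero.2 h0
      have f1 : u₁ = 0 := (mul_eq_zero.1 (by linear_combination -e2 - w₃ * e1 :
        (w₃ ^ 2 - 1) * u₁ = 0)).resolve_left h0'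
      have f2 : u₂ = 0 := (mul_eq_zero.1 (by linear_combination -e4 + w₃ * e3 :
        (w₃ ^ 2 - 1) * u₂ = 0)).resolve_left h0'
      subst f1 f2
      linarith
    have : w₃ = 1 := by nlinarith
    rw [this, mul_one] at hw3
    exact Subtype.ext hw3

/-- Negative s are needed: they join the two sheets of 2xy - z² = k for k > 0, and the two halves of
the null cone. -/
theorem reducedEquiv_sl2_scale {e : Basis (Fin 3) ℝ L} (h : Row.sl2.brackets.Holds e) (x y z : ℝ)
    {s : ℝ} (hs : s ≠ 0) :
    ReducedEquiv e (bivec e x y z) (bivec e (s * x) (s⁻¹ * y) z) := by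
  refine Row.sl2.reducedEquiv h 1 0 0 0 s 0 0 0 s⁻¹ ?_ ?_ ?_
  · simp [hs]
  · simp [Row.brackets, Brackets.ChangesTo, hs]
  · simp [Row.Invariant, hs, mul_comm]

theorem reducedEquiv_sl2_swap {e : Basis (Fin 3) ℝ L} (h : Row.sl2.brackets.Holds e) (x y z : ℝ) :
    ReducedEquiv e (bivec e x y z) (bivec e (-y) (-x) (-z)) := by
  refine Row.sl2.reducedEquiv h (-1) 0 0 0 0 1 0 1 0 ?_ ?_ ?_
  · simp
  · simp [Row.brackets, Brackets.ChangesTo]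
  · simp [Row.Invariant]

/-- The automorphism is exp(-t ad e₂). -/
theorem reducedEquiv_sl2_unipotent {e : Basis (Fin 3) ℝ L} (h : Row.sl2.brackets.Holds e)
    (x y z t : ℝ) :
    ReducedEquiv e (bivec e x y z) (bivec e (x + t * z + t ^ 2 / 2 * y) y (z + t * y)) := by
  refine Row.sl2.reducedEquiv h 1 t 0 0 1 0 (-t) (-t ^ 2 / 2) 1 ?_ ?_ ?_
  · simp
  · simp [Row.brackets, Brackets.ChangesTo]
    ring
  · simp [Row.Invariant]
    constructor <;> ring

/-- A representative of the orbit of a bivector of `sl₂` that is not a multiple of `e₂₃`. -/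
theorem exists_reducedEquiv_sl2 {e : Basis (Fin 3) ℝ L} (h : Row.sl2.brackets.Holds e) {x y z : ℝ}
    (hxy : x ^ 2 + y ^ 2 ≠ 0) : ∃ y', y' ≠ 0 ∧
      ReducedEquiv e (bivec e x y z) (bivec e ((2 * x * y - z ^ 2) / (2 * y')) y' 0) := by
  by_cases hy : y = 0
  · have hx : x ≠ 0 := by rintro rfl; simp [hy] at hxy
    refine ⟨-x, by simpa using hx, ?_⟩
    -- A unipotent map can remove z only when y ≠ 0, so the swap comes first here. Invariance of 2xy
    -- - z² then dictates the first coordinate.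
    convert (reducedEquiv_sl2_swap h x y z).trans
      (reducedEquiv_sl2_unipotent h (-y) (-x) (-z) (-z / x)) using 2
    · rw [hy]
      field_simp
      ring
    · field_simp
      ring
  · refine ⟨y, hy, ?_⟩
    convert reducedEquiv_sl2_unipotent h x y z (-z / y) using 2
    · field_simp
      ring
    · field_simp
      ring

theorem reducedEquiv_sl2_neg {e : Basis (Fin 3) ℝ L} (h : Row.sl2.brackets.Holds e) {x y z a : ℝ}
    (ha : 0 < a) (hr : 2 * x * y - z ^ 2 = -a ^ 2) :
    ReducedEquiv e (bivec e x y z) (bivec e 0 0 a) := by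
  by_cases hxy : x ^ 2 + y ^ 2 = 0
  · have hx : x = 0 := by nlinarith
    have hy : y = 0 := by nlinarith
    subst hx hy
    have : (z - a) * (z + a) = 0 := by linarith
    rcases mul_eq_zero.1 this with h0 | h0
    · rw [sub_eq_zero.1 h0]
      exact ⟨LieEquiv.refl, by rw [mapTwo_refl]⟩
    · convert reducedEquiv_sl2_swap h 0 0 z using 2 <;> linarith
  · obtain ⟨y', hy', h1⟩ := exists_reducedEquiv_sl2 (z := z) h hxy
    rw [hr] at h1
    refine h1.trans (ReducedEquiv.symm ?_)
    -- These moves lead from (0, 0, a) through (a, 0, a) and (0, -a, -a) to (a/2, -a, 0), which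
    -- scaling adjusts to the required second coordinate.
    have h2 := reducedEquiv_sl2_unipotent h 0 0 a 1
    have h3 := reducedEquiv_sl2_swap h (0 + 1 * a + 1 ^ 2 / 2 * 0) 0 (a + 1 * 0)
    have h4 := reducedEquiv_sl2_unipotent h (-0) (-(0 + 1 * a + 1 ^ 2 / 2 * 0)) (-(a + 1 * 0)) (-1)
    have h5 := ((h2.trans h3).trans h4).trans (reducedEquiv_sl2_scale h _ _ _
      (s := -a / y') (by simp [ha.ne', hy']))
    convert h5 using 2
    · field_simp
      ring
    · field_simp
      ring
    · ring

theorem reducedEquiv_sl2_pos {e : Basis (Fin 3) ℝ L} (h : Row.sl2.brackets.Holds e) {x y z a : ℝ}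
    (ha : 0 < a) (hr : 2 * x * y - z ^ 2 = 2 * a ^ 2) :
    ReducedEquiv e (bivec e x y z) (bivec e a a 0) := by
  have hxy : x ^ 2 + y ^ 2 ≠ 0 := by nlinarith [sq_nonneg (x - y)]
  obtain ⟨y', hy', h1⟩ := exists_reducedEquiv_sl2 (z := z) h hxy
  rw [hr] at h1
  refine h1.trans ?_
  convert reducedEquiv_sl2_scale h _ _ _ (s := y' / a) (by simp [ha.ne', hy']) using 2
  · field_simp
  · field_simp

theorem reducedEquiv_sl2_null {e : Basis (Fin 3) ℝ L} (h : Row.sl2.brackets.Holds e) {x y z : ℝ}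
    (hr : 2 * x * y - z ^ 2 = 0) (hxy : x ^ 2 + y ^ 2 ≠ 0) :
    ReducedEquiv e (bivec e x y z) (bivec e 1 0 0) := by
  obtain ⟨y', hy', h1⟩ := exists_reducedEquiv_sl2 (z := z) h hxy
  rw [hr] at h1
  refine h1.trans ((reducedEquiv_sl2_swap h _ _ _).trans ?_)
  convert reducedEquiv_sl2_scale h _ _ _ (s := -y'⁻¹) (by simp [hy']) using 2
  · field_simp
  · simp
  · simp

theorem trace_ad_sq_sl2 {e : Basis (Fin 3) ℝ L} (h : Row.sl2.brackets.Holds e) (p q r : ℝ) :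
    LinearMap.trace ℝ L (LieAlgebra.ad ℝ L (lin e p q r) * LieAlgebra.ad ℝ L (lin e p q r)) =
      2 * (p ^ 2 + 2 * q * r) := by
  rw [LinearMap.trace_eq_matrix_trace ℝ e, Matrix.trace, Fin.sum_univ_three]
  simp only [Matrix.diag_apply, LinearMap.toMatrix_apply, Module.End.mul_apply, LieAlgebra.ad_apply]
  rw [basis_zero_eq_lin, basis_one_eq_lin, basis_two_eq_lin]
  simp only [h.lie_lin]
  simp [lin, Row.brackets]
  ring

/-- The bracket map Λ²g → g sends (x, y, z) to z e₁ + x e₂ - y e₃ and commutes with automorphisms.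
The Killing form of the image is -2(2xy - z²), and being a trace it does not see the change of
basis. -/
theorem eq_of_reducedEquiv_sl2 {e : Basis (Fin 3) ℝ L} (h : Row.sl2.brackets.Holds e)
    {x y z x' y' z' : ℝ} (hr : ReducedEquiv e (bivec e x y z) (bivec e x' y' z')) :
    2 * x * y - z ^ 2 = 2 * x' * y' - z' ^ 2 := by
  obtain ⟨f, h', hf⟩ := h.exists_basis_of_reducedEquiv hr
  obtain ⟨u₁, u₂, u₃, hu⟩ := exists_lin e (f 0)
  obtain ⟨v₁, v₂, v₃, hv⟩ := exists_lin e (f 1)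
  obtain ⟨w₁, w₂, w₃, hw⟩ := exists_lin e (f 2)
  have hp := (h.holds_iff_changesTo hu hv hw).1 h'
  rw [bivec_lin e f hu hv hw, bivec_sub, Row.bivec_mem_inv2_iff _ h] at hf
  simp only [Row.brackets, Brackets.ChangesTo, Row.Invariant] at hp hf
  obtain ⟨⟨h1, h2, h3⟩, ⟨h4, h5, h6⟩, h7, h8, h9⟩ := hp
  have hl : lin f z x (-y) = lin e z' x' (-y') := by
    rw [lin_lin e f hu hv hw, lin_inj]
    refine ⟨?_, ?_, ?_⟩
    · linear_combination hf.2.2 - x * h1 - y * h4 + z * h7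
    · linear_combination hf.1 - x * h2 - y * h5 + z * h8
    · linear_combination -hf.2.1 - x * h3 - y * h6 + z * h9
  have ht := trace_ad_sq_sl2 h' z x (-y)
  rw [hl, trace_ad_sq_sl2 h] at ht
  linarith

theorem classified_sl2 {e : Basis (Fin 3) ℝ L} (h : Row.sl2.brackets.Holds e) :
    Row.sl2.Classified e := by
  refine Row.sl2.classified_of_family h (ι := {a : ℝ // 0 < a} ⊕ {a : ℝ // 0 < a} ⊕ Unit)
    -- The levels are parametrized by the representatives: a e₂₃ has value -a², and a(e₁₂ + e₁₃) has
    -- value 2a².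
    (Sum.elim (fun a x y z => 2 * x * y - z ^ 2 = -a.1 ^ 2)
      (Sum.elim (fun a x y z => 2 * x * y - z ^ 2 = 2 * a.1 ^ 2)
        fun _ x y z => 2 * x * y - z ^ 2 = 0 ∧ x ^ 2 + y ^ 2 ≠ 0))
    (Sum.elim (fun _ => 0) (Sum.elim (fun a => a.1) fun _ => 1))
    (Sum.elim (fun _ => 0) (Sum.elim (fun a => a.1) fun _ => 0))
    (Sum.elim (fun a => a.1) (Sum.elim (fun _ => 0) fun _ => 0)) ?_ ?_ ?_ ?_ ?_ ?_
  · ext C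
    simp only [Row.classes, Set.mem_union, Set.mem_ofPred_eq, Set.mem_singleton_iff, Set.mem_range,
      Sum.exists, Sum.elim_inl, Sum.elim_inr, Subtype.exists]
    constructor
    · rintro (⟨k, hk, rfl⟩ | rfl)
      · rcases lt_or_gt_of_ne hk with hk | hk
        · exact Or.inl ⟨√(-k), Real.sqrt_pos.2 (by linarith), by
            simp only [Real.sq_sqrt (neg_pos.2 hk).le, neg_neg]⟩
        · refine Or.inr (Or.inl ⟨√(k / 2), Real.sqrt_pos.2 (by linarith), ?_⟩)
          have : 2 * √(k / 2) ^ 2 = k := by rw [Real.sq_sqrt (by linarith)]; ring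
          simp only [this]
      · exact Or.inr (Or.inr ⟨(), rfl⟩)
    · rintro (⟨a, ha, rfl⟩ | ⟨a, ha, rfl⟩ | ⟨_, rfl⟩)
      · exact Or.inl ⟨-a ^ 2, by simp [ha.ne'], rfl⟩
      · exact Or.inl ⟨2 * a ^ 2, by positivity, rfl⟩
      · exact Or.inr rfl
  · ext r
    simp [Row.reps, e12_eq_bivec, e13_eq_bivec, e23_eq_bivec, bivec_smul, bivec_add, eq_comm]
    exact or_comm.trans or_assoc
  · intro x y z
    simp only [Row.YB, Row.Invariant, Sum.exists, Sum.elim_inl, Sum.elim_inr, Subtype.exists,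
      true_and, exists_const]
    constructor
    · rintro (⟨a, ha, h1⟩ | ⟨a, ha, h1⟩ | ⟨h1, h2⟩) ⟨rfl, rfl, rfl⟩
      · nlinarith
      · nlinarith
      · simp at h2
    · intro h1
      rcases lt_trichotomy (2 * x * y - z ^ 2) 0 with hk | hk | hk
      · exact Or.inl ⟨√(-(2 * x * y - z ^ 2)), Real.sqrt_pos.2 (by linarith), by
          rw [Real.sq_sqrt (by linarith), neg_neg]⟩
      · refine Or.inr (Or.inr ⟨hk, fun h0 => h1 ?_⟩)
        have hx : x = 0 := by nlinarith
        have hy : y = 0 := by nlinarith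
        subst hx hy
        exact ⟨rfl, rfl, by nlinarith⟩
      · exact Or.inr (Or.inl ⟨√((2 * x * y - z ^ 2) / 2), Real.sqrt_pos.2 (by linarith), by
          rw [Real.sq_sqrt (by linarith)]; ring⟩)
  · rintro (a | a | _)
    · simp
    · simp; ring
    · simp
  · rintro (a | a | _) x y z hr
    · exact reducedEquiv_sl2_neg h a.2 hr
    · exact reducedEquiv_sl2_pos h a.2 hr
    · exact reducedEquiv_sl2_null h hr.1 hr.2
  · intro i j hr
    have := eq_of_reducedEquiv_sl2 h hr
    rcases i with ⟨a, ha⟩ | ⟨a, ha⟩ | _ <;> rcases j with ⟨b, hb⟩ | ⟨b, hb⟩ | _ <;>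
      simp only [Sum.elim_inl, Sum.elim_inr] at this
    · have : a = b := by nlinarith
      subst this; rfl
    · nlinarith
    · nlinarith
    · nlinarith
    · have : a = b := by nlinarith
      subst this; rfl
    · nlinarith
    · nlinarith
    · nlinarith
    · rfl

theorem Row.classified (t : Row) {e : Basis (Fin 3) ℝ L} (h : t.brackets.Holds e) :
    t.Classified e := by
  cases t with
  | sl2 => exact classified_sl2 h
  | su2 => exact classified_su2 h
  | heis => exact classified_heis h
  | r30' => exact classified_r30' h
  | r3m1 => exact classified_r3m1 h
  | r31 => exact classified_r31 h
  | r3 => exact classified_r3 h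
  | r3l l hl => exact classified_r3l l hl h
  | r3l' l hl => exact classified_r3l' l hl h

end

/-! ### Existence of a Lie algebra for each row -/

section Models

/-- The vector space `ℝ³` with the bracket of a row. -/
def Row.Model (_ : Row) : Type := Fin 3 → ℝ

instance (t : Row) : AddCommGroup t.Model := inferInstanceAs (AddCommGroup (Fin 3 → ℝ))

instance (t : Row) : Module ℝ t.Model := inferInstanceAs (Module ℝ (Fin 3 → ℝ))

/-- The bracket on `ℝ³` with the given structure constants. -/
def Brackets.lie (s : Brackets) (x y : Fin 3 → ℝ) : Fin 3 → ℝ :=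
  (x 0 * y 1 - x 1 * y 0) • ![s.a₁, s.a₂, s.a₃] + (x 0 * y 2 - x 2 * y 0) • ![s.b₁, s.b₂, s.b₃] +
    (x 2 * y 1 - x 1 * y 2) • ![s.c₁, s.c₂, s.c₃]

theorem Row.lie_jacobi (t : Row) (x y z : Fin 3 → ℝ) :
    t.brackets.lie x (t.brackets.lie y z) =
      t.brackets.lie (t.brackets.lie x y) z + t.brackets.lie y (t.brackets.lie x z) := by
  ext i
  cases t <;> fin_cases i <;> simp [Brackets.lie, Row.brackets] <;> ring

instance (t : Row) : LieRing t.Model where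
  bracket x y := t.brackets.lie x y
  add_lie x y z := by
    change t.brackets.lie (fun i => x i + y i) z = _
    ext i
    change _ = t.brackets.lie x z i + t.brackets.lie y z i
    simp only [Brackets.lie, Pi.add_apply, Pi.smul_apply, smul_eq_mul]
    ring
  lie_add x y z := by
    change t.brackets.lie x (fun i => y i + z i) = _
    ext i
    change _ = t.brackets.lie x y i + t.brackets.lie x z i
    simp only [Brackets.lie, Pi.add_apply, Pi.smul_apply, smul_eq_mul]
    ring
  lie_self x := by
    change t.brackets.lie x x = (0 : Fin 3 → ℝ)
    ext i
    simp only [Brackets.lie, Pi.add_apply, Pi.smul_apply, smul_eq_mul, Pi.zero_apply]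
    ring
  leibniz_lie x y z := t.lie_jacobi x y z

instance (t : Row) : LieAlgebra ℝ t.Model where
  lie_smul c x y := by
    change t.brackets.lie x (fun i => c * y i) = _
    ext i
    change _ = c * t.brackets.lie x y i
    simp only [Brackets.lie, Pi.add_apply, Pi.smul_apply, smul_eq_mul]
    ring

/-- The coordinates of a vector of the model of a row. -/
def Row.Model.coord {t : Row} (x : t.Model) : Fin 3 → ℝ := x

/-- The standard basis of the model of a row. -/
def Row.modelBasis (t : Row) : Basis (Fin 3) ℝ t.Model := Pi.basisFun ℝ (Fin 3)

theorem Row.coord_modelBasis (t : Row) (i j : Fin 3) :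
    (t.modelBasis i).coord j = if j = i then 1 else 0 :=
  (congrFun (Pi.basisFun_apply ℝ (Fin 3) i) j).trans (Pi.single_apply i 1 j)

theorem Row.modelBasis_holds (t : Row) : t.brackets.Holds t.modelBasis := by
  have hl (a b c : ℝ) (i : Fin 3) : (lin t.modelBasis a b c).coord i = ![a, b, c] i := by
    change a * (t.modelBasis 0).coord i + b * (t.modelBasis 1).coord i +
      c * (t.modelBasis 2).coord i = _
    simp only [Row.coord_modelBasis]
    fin_cases i <;> simp
  have hb (i j m : Fin 3) : ⁅t.modelBasis i, t.modelBasis j⁆.coord m =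
      t.brackets.lie (t.modelBasis i).coord (t.modelBasis j).coord m := rfl
  refine ⟨?_, ?_, ?_⟩
  all_goals
    refine funext fun m : Fin 3 => (hb _ _ m).trans (Eq.trans ?_ (hl _ _ _ m).symm)
    simp [Brackets.lie, Row.coord_modelBasis]

end Models

/-! ### Completeness of the table -/

section

variable {L : Type*} [LieRing L] [LieAlgebra ℝ L]

theorem Brackets.Holds.exists_of_changesTo {s s' : Brackets} {e : Basis (Fin 3) ℝ L} (h : s.Holds e)
    (u₁ u₂ u₃ v₁ v₂ v₃ w₁ w₂ w₃ : ℝ)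
    (hdet : u₁ * (v₂ * w₃ - v₃ * w₂) - u₂ * (v₁ * w₃ - v₃ * w₁) + u₃ * (v₁ * w₂ - v₂ * w₁) ≠ 0)
    (hc : s.ChangesTo s' u₁ u₂ u₃ v₁ v₂ v₃ w₁ w₂ w₃) :
    ∃ f : Basis (Fin 3) ℝ L, s'.Holds f := by
  obtain ⟨f, hu, hv, hw⟩ := exists_basis_lin e hdet
  exact ⟨f, (h.holds_iff_changesTo hu hv hw).2 hc⟩

/-- The Lie algebra has a basis that satisfies the relations of some row. -/
def HasRow (L : Type*) [LieRing L] [LieAlgebra ℝ L] : Prop :=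
  ∃ (t : Row) (f : Basis (Fin 3) ℝ L), t.brackets.Holds f

section Unimodular

/-- The relations `[e₁, e₂] = γ e₃`, `[e₂, e₃] = α e₁`, `[e₃, e₁] = β e₂`. -/
def diagonalBrackets (α β γ : ℝ) : Brackets := ⟨0, 0, γ, 0, -β, 0, -α, 0, 0⟩

variable {e : Basis (Fin 3) ℝ L} {α β γ : ℝ}

theorem exists_holds_diagonal_rotate (h : (diagonalBrackets α β γ).Holds e) :
    ∃ f : Basis (Fin 3) ℝ L, (diagonalBrackets β γ α).Holds f :=
  h.exists_of_changesTo 0 1 0 0 0 1 1 0 0 (by simp) (by simp [diagonalBrackets, Brackets.ChangesTo])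

theorem hasRow_of_diagonal_rank_one (h : (diagonalBrackets 0 0 γ).Holds e) (hγ : γ ≠ 0) :
    HasRow L :=
  ⟨.heis, h.exists_of_changesTo 1 0 0 0 1 0 0 0 γ (by simpa using hγ)
    (by simp [diagonalBrackets, Brackets.ChangesTo, Row.brackets])⟩

/-- With k² = -βγ, the vectors e₂ ± (γ/k) e₃ are eigenvectors of ad(e₁/k) for ±1. Their bracket is a
multiple of αe₁, so α = 0 gives r_{3,-1}; otherwise rescaling one of them gives sl₂. -/
theorem hasRow_of_diagonal_neg (h : (diagonalBrackets α β γ).Holds e) (hβγ : β * γ < 0) :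
    HasRow L := by
  have hk := Real.sq_sqrt (by linarith : 0 ≤ -(β * γ))
  have hk0 := Real.sqrt_pos.2 (by linarith : 0 < -(β * γ))
  set k := √(-(β * γ))
  have hγ : γ ≠ 0 := by rintro rfl; simp at hβγ
  by_cases hα : α = 0
  · subst hα
    refine ⟨.r3m1, h.exists_of_changesTo k⁻¹ 0 0 0 1 (γ / k) 0 1 (-γ / k) ?_ ?_⟩
    · have : -2 * γ / k ^ 2 ≠ 0 := by
        simp [hγ, hk0.ne']
      convert this using 1
      field_simp
      ring
    · simp [diagonalBrackets, Brackets.ChangesTo, Row.brackets]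
      refine ⟨⟨?_, ?_⟩, ?_, ?_⟩ <;> field_simp <;> linarith
  · refine ⟨.sl2, h.exists_of_changesTo k⁻¹ 0 0 0 1 (γ / k) 0 (-1 / (2 * α * γ))
      (1 / (2 * α * k)) ?_ ?_⟩
    · have : 1 / (α * k ^ 2) ≠ 0 := by positivity
      convert this using 1
      field_simp
      ring
    · simp [diagonalBrackets, Brackets.ChangesTo, Row.brackets]
      refine ⟨⟨?_, ?_⟩, ⟨?_, ?_⟩, ?_⟩ <;> field_simp <;> linarith

theorem hasRow_of_diagonal_rank_two (h : (diagonalBrackets 0 β γ).Holds e) (hβγ : 0 < β * γ) :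
    HasRow L := by
  have hk := Real.sq_sqrt hβγ.le
  have hk0 := Real.sqrt_pos.2 hβγ
  set k := √(β * γ)
  have hγ : γ ≠ 0 := by rintro rfl; simp at hβγ
  refine ⟨.r30', h.exists_of_changesTo k⁻¹ 0 0 0 1 0 0 0 (-γ / k) ?_ ?_⟩
  · simp [hγ, hk0.ne']
  · simp [diagonalBrackets, Brackets.ChangesTo, Row.brackets]
    refine ⟨?_, ?_⟩ <;> field_simp
    linarith

theorem hasRow_of_diagonal_definite (h : (diagonalBrackets α β γ).Holds e) (hβγ : 0 < β * γ)
    (hαγ : 0 < α * γ) : HasRow L := by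
  have hk := Real.sq_sqrt hβγ.le
  have hk0 := Real.sqrt_pos.2 hβγ
  set k := √(β * γ)
  have hm := Real.sq_sqrt hαγ.le
  have hm0 := Real.sqrt_pos.2 hαγ
  set m := √(α * γ)
  have hγ : γ ≠ 0 := by rintro rfl; simp at hβγ
  refine ⟨.su2, h.exists_of_changesTo k⁻¹ 0 0 0 m⁻¹ 0 0 0 (γ / (k * m)) ?_ ?_⟩
  · simp [hγ, hk0.ne', hm0.ne']
  · simp [diagonalBrackets, Brackets.ChangesTo, Row.brackets]
    refine ⟨?_, ?_, ?_⟩ <;> field_simp <;> linarith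

/-- Only the signs of the pairwise products matter, up to cyclic rotation: a negative one gives sl₂
or r_{3,-1}, all positive su₂, a single nonzero positive one r'_{3,0}, and all zero the Heisenberg
algebra. -/
theorem hasRow_of_diagonal (h : (diagonalBrackets α β γ).Holds e)
    (h0 : ¬ (α = 0 ∧ β = 0 ∧ γ = 0)) : HasRow L := by
  obtain ⟨f, hf⟩ := exists_holds_diagonal_rotate h
  obtain ⟨g, hg⟩ := exists_holds_diagonal_rotate hf
  rcases lt_trichotomy (β * γ) 0 with h1 | h1 | h1
  · exact hasRow_of_diagonal_neg h h1
  · rcases lt_trichotomy (γ * α) 0 with h2 | h2 | h2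
    · exact hasRow_of_diagonal_neg hf h2
    · rcases lt_trichotomy (α * β) 0 with h3 | h3 | h3
      · exact hasRow_of_diagonal_neg hg h3
      · by_cases hα : α = 0
        · subst hα
          by_cases hβ : β = 0
          · subst hβ
            exact hasRow_of_diagonal_rank_one h (by simpa using h0)
          · obtain rfl : γ = 0 := (mul_eq_zero.1 h1).resolve_left hβ
            exact hasRow_of_diagonal_rank_one hg hβ
        · obtain rfl : β = 0 := (mul_eq_zero.1 h3).resolve_left hα
          obtain rfl : γ = 0 := (mul_eq_zero.1 h2).resolve_right hα
          exact hasRow_of_diagonal_rank_one hf hα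
      · obtain rfl : γ = 0 := (mul_eq_zero.1 h1).resolve_left (right_ne_zero_of_mul h3.ne')
        exact hasRow_of_diagonal_rank_two hg h3
    · obtain rfl : β = 0 := (mul_eq_zero.1 h1).resolve_right (left_ne_zero_of_mul h2.ne')
      exact hasRow_of_diagonal_rank_two hf h2
  · rcases lt_trichotomy (γ * α) 0 with h2 | h2 | h2
    · exact hasRow_of_diagonal_neg hf h2
    · obtain rfl : α = 0 := (mul_eq_zero.1 h2).resolve_left (right_ne_zero_of_mul h1.ne')
      exact hasRow_of_diagonal_rank_two h h1
    · exact hasRow_of_diagonal_definite h h1 (by linarith)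

/-- A symmetric `3 × 3` matrix has eigenvectors `u, v, w` with `u × v`, `v × w`, `w × u` equal to
a nonzero multiple of `w`, `u`, `v`. -/
theorem exists_eigenvectors (n₁₁ n₁₂ n₁₃ n₂₂ n₂₃ n₃₃ : ℝ) :
    ∃ u v w : Fin 3 → ℝ, ∃ a b c k : ℝ, k ≠ 0 ∧
      u 0 * (v 1 * w 2 - v 2 * w 1) - u 1 * (v 0 * w 2 - v 2 * w 0) +
        u 2 * (v 0 * w 1 - v 1 * w 0) = k ∧
      crossProduct u v = k • w ∧ crossProduct v w = k • u ∧ crossProduct w u = k • v ∧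
      Matrix.mulVec !![n₁₁, n₁₂, n₁₃; n₁₂, n₂₂, n₂₃; n₁₃, n₂₃, n₃₃] u = a • u ∧
      Matrix.mulVec !![n₁₁, n₁₂, n₁₃; n₁₂, n₂₂, n₂₃; n₁₃, n₂₃, n₃₃] v = b • v ∧
      Matrix.mulVec !![n₁₁, n₁₂, n₁₃; n₁₂, n₂₂, n₂₃; n₁₃, n₂₃, n₃₃] w = c • w := by
  set N : Matrix (Fin 3) (Fin 3) ℝ := !![n₁₁, n₁₂, n₁₃; n₁₂, n₂₂, n₂₃; n₁₃, n₂₃, n₃₃] with hN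
  have hH : N.IsHermitian := by
    ext i j
    fin_cases i <;> fin_cases j <;> simp [hN]
  set B := hH.eigenvectorBasis
  have hB (i j : Fin 3) : B i 0 * B j 0 + B i 1 * B j 1 + B i 2 * B j 2 = if i = j then 1 else 0 := by
    have := orthonormal_iff_ite.1 B.orthonormal i j
    rw [PiLp.inner_apply, Fin.sum_univ_three] at this
    simp only [RCLike.inner_apply, conj_trivial] at this
    rw [← this]
    ring
  -- Expanding a cross product of two basis vectors in the orthonormal basis leaves only the third
  -- one, with the triple product k as coefficient.
  have hsum (x : Fin 3 → ℝ) (m : Fin 3) : x m = (B 0 0 * x 0 + B 0 1 * x 1 + B 0 2 * x 2) * B 0 m +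
      (B 1 0 * x 0 + B 1 1 * x 1 + B 1 2 * x 2) * B 1 m +
      (B 2 0 * x 0 + B 2 1 * x 1 + B 2 2 * x 2) * B 2 m := by
    have := congrArg (fun y : EuclideanSpace ℝ (Fin 3) => y m) (B.sum_repr' (WithLp.toLp 2 x))
    simp only [Fin.sum_univ_three, PiLp.add_apply, PiLp.smul_apply, PiLp.inner_apply,
      RCLike.inner_apply, conj_trivial, smul_eq_mul] at this
    linear_combination -this
  have h00 := hB 0 0
  have h11 := hB 1 1
  have h22 := hB 2 2
  have h01 := hB 0 1
  simp at h00 h11 h22 h01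
  set k := B 0 0 * (B 1 1 * B 2 2 - B 1 2 * B 2 1) - B 0 1 * (B 1 0 * B 2 2 - B 1 2 * B 2 0) +
    B 0 2 * (B 1 0 * B 2 1 - B 1 1 * B 2 0) with hk
  have c1 : crossProduct (B 0 : Fin 3 → ℝ) (B 1) = k • (B 2 : Fin 3 → ℝ) := by
    funext m
    rw [hsum (crossProduct (B 0 : Fin 3 → ℝ) (B 1)) m]
    simp only [cross_apply, Pi.smul_apply, smul_eq_mul, hk]
    simp
    ring
  have c2 : crossProduct (B 1 : Fin 3 → ℝ) (B 2) = k • (B 0 : Fin 3 → ℝ) := by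
    funext m
    rw [hsum (crossProduct (B 1 : Fin 3 → ℝ) (B 2)) m]
    simp only [cross_apply, Pi.smul_apply, smul_eq_mul, hk]
    simp
    ring
  have c3 : crossProduct (B 2 : Fin 3 → ℝ) (B 0) = k • (B 1 : Fin 3 → ℝ) := by
    funext m
    rw [hsum (crossProduct (B 2 : Fin 3 → ℝ) (B 0)) m]
    simp only [cross_apply, Pi.smul_apply, smul_eq_mul, hk]
    simp
    ring
  refine ⟨B 0, B 1, B 2, hH.eigenvalues 0, hH.eigenvalues 1, hH.eigenvalues 2, k, ?_, hk.symm, c1,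
    c2, c3, hH.mulVec_eigenvectorBasis 0, hH.mulVec_eigenvectorBasis 1,
    hH.mulVec_eigenvectorBasis 2⟩
  intro h0
  rw [h0, zero_smul] at c1
  have d0 := congrFun c1 0
  have d1 := congrFun c1 1
  have d2 := congrFun c1 2
  simp [cross_apply] at d0 d1 d2
  -- Lagrange's identity: a vanishing cross product contradicts that the two vectors are
  -- orthonormal.
  have : (B 0 0 ^ 2 + B 0 1 ^ 2 + B 0 2 ^ 2) * (B 1 0 ^ 2 + B 1 1 ^ 2 + B 1 2 ^ 2) -
      (B 0 0 * B 1 0 + B 0 1 * B 1 1 + B 0 2 * B 1 2) ^ 2 = 0 := by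
    linear_combination (B 0 1 * B 1 2 - B 0 2 * B 1 1) * d0 + (B 0 2 * B 1 0 - B 0 0 * B 1 2) * d1 +
      (B 0 0 * B 1 1 - B 0 1 * B 1 0) * d2
  nlinarith

/-- Let N have columns [e₂, e₃], [e₃, e₁], [e₁, e₂], so that [u, v] = N(u × v). The three trace
conditions say precisely that N is symmetric. On eigenvectors with u × v = kw the bracket is k times
the eigenvalue times w, so the relations become diagonal. -/
theorem hasRow_of_unimodular {s : Brackets} (h : s.Holds e) (h1 : s.a₂ + s.b₃ = 0)
    (h2 : s.a₁ + s.c₃ = 0) (h3 : s.c₂ - s.b₁ = 0) (hL : ¬ IsLieAbelian L) : HasRow L := by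
  obtain ⟨u, v, w, a, b, c, k, hk, hdet, c1, c2, c3, hu, hv, hw⟩ :=
    exists_eigenvectors (-s.c₁) (-s.b₁) s.a₁ (-s.b₂) s.a₂ s.a₃
  have hf : ∃ f : Basis (Fin 3) ℝ L, (diagonalBrackets (k * a) (k * b) (k * c)).Holds f := by
    refine h.exists_of_changesTo (u 0) (u 1) (u 2) (v 0) (v 1) (v 2) (w 0) (w 1) (w 2)
      (by rw [hdet]; exact hk) ?_
    have e1 := fun i => congrFun c1 i
    have e2 := fun i => congrFun c2 i
    have e3 := fun i => congrFun c3 i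
    have e4 := fun i => congrFun hu i
    have e5 := fun i => congrFun hv i
    have e6 := fun i => congrFun hw i
    simp only [Fin.forall_fin_succ, cross_apply, Pi.smul_apply, smul_eq_mul, Matrix.mulVec,
      dotProduct, Fin.sum_univ_three] at e1 e2 e3 e4 e5 e6
    simp at e1 e2 e3 e4 e5 e6
    obtain ⟨e10, e11, e12⟩ := e1
    obtain ⟨e20, e21, e22⟩ := e2
    obtain ⟨e30, e31, e32⟩ := e3
    obtain ⟨e40, e41, e42⟩ := e4
    obtain ⟨e50, e51, e52⟩ := e5
    obtain ⟨e60, e61, e62⟩ := e6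
    have hb3 : s.b₃ = -s.a₂ := by linarith
    have hc3 : s.c₃ = -s.a₁ := by linarith
    have hc2 : s.c₂ = s.b₁ := by linarith
    simp only [Brackets.ChangesTo, diagonalBrackets, hb3, hc3, hc2]
    refine ⟨⟨?_, ?_, ?_⟩, ⟨?_, ?_, ?_⟩, ?_, ?_, ?_⟩
    · linear_combination s.a₁ * e12 - s.b₁ * e11 - s.c₁ * e10 + k * e60
    · linear_combination s.a₂ * e12 - s.b₂ * e11 - s.b₁ * e10 + k * e61
    · linear_combination s.a₃ * e12 + s.a₂ * e11 + s.a₁ * e10 + k * e62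
    · linear_combination -s.a₁ * e32 + s.b₁ * e31 + s.c₁ * e30 - k * e50
    · linear_combination -s.a₂ * e32 + s.b₂ * e31 + s.b₁ * e30 - k * e51
    · linear_combination -s.a₃ * e32 - s.a₂ * e31 - s.a₁ * e30 - k * e52
    · linear_combination -s.a₁ * e22 + s.b₁ * e21 + s.c₁ * e20 - k * e40
    · linear_combination -s.a₂ * e22 + s.b₂ * e21 + s.b₁ * e20 - k * e41
    · linear_combination -s.a₃ * e22 - s.a₂ * e21 - s.a₁ * e20 - k * e42
  obtain ⟨f, hf⟩ := hf
  refine hasRow_of_diagonal hf fun ⟨z1, z2, z3⟩ => hL ⟨fun x y => ?_⟩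
  obtain ⟨p, q, r, rfl⟩ := exists_lin f x
  obtain ⟨p', q', r', rfl⟩ := exists_lin f y
  rw [hf.lie_lin, lin_eq_zero_iff]
  simp [diagonalBrackets, z1, z2, z3]

end Unimodular

/-! ### The non-unimodular case: normal forms of a 2 × 2 matrix -/

section NonUnimodular

/-- The relations of `ℝ e₃ ⋉ ⟨e₁, e₂⟩` with `[e₃, e₁] = p e₁ + r e₂` and `[e₃, e₂] = q e₁ + s e₂`. -/
def semidirectBrackets (p q r s : ℝ) : Brackets := ⟨0, 0, 0, -p, -r, 0, q, s, 0⟩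

variable {e : Basis (Fin 3) ℝ L} {p q r s : ℝ}

theorem hasRow_of_semidirect_lt (h : (semidirectBrackets p 0 0 s).Holds e) (hps : |s| < |p|) :
    HasRow L := by
  have hp : p ≠ 0 := by rintro rfl; simp at hps; linarith [abs_nonneg s]
  have hl : |s / p| < 1 := by
    rw [abs_div, div_lt_one (abs_pos.2 hp)]
    exact hps
  refine ⟨.r3l (s / p) (abs_lt.1 hl), h.exists_of_changesTo 1 0 0 0 1 0 0 0 p⁻¹ ?_ ?_⟩
  · simpa using hp
  · simp [semidirectBrackets, Brackets.ChangesTo, Row.brackets, hp]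
    ring

theorem hasRow_of_semidirect_diagonal (h : (semidirectBrackets p 0 0 s).Holds e) (hps : p + s ≠ 0) :
    HasRow L := by
  rcases lt_trichotomy |s| |p| with h1 | h1 | h1
  · exact hasRow_of_semidirect_lt h h1
  · rcases abs_eq_abs.1 h1 with rfl | rfl
    · have hs : s ≠ 0 := by contrapose! hps; linarith
      refine ⟨.r31, h.exists_of_changesTo 0 0 s⁻¹ 1 0 0 0 1 0 ?_ ?_⟩
      · simpa using hs
      · simp [semidirectBrackets, Brackets.ChangesTo, Row.brackets, hs]
    · simp at hps
  · obtain ⟨f, hf⟩ : ∃ f : Basis (Fin 3) ℝ L, (semidirectBrackets s 0 0 p).Holds f :=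
      h.exists_of_changesTo 0 1 0 1 0 0 0 0 1 (by simp)
        (by simp [semidirectBrackets, Brackets.ChangesTo])
    exact hasRow_of_semidirect_lt hf h1

/-- The characteristic polynomial λ² - sλ - q has discriminant s² + 4q. Complex roots (s ± ik)/2
become s/k ± i after scaling e₃ by 2/k. A double root s/2 becomes 1, with a genuine Jordan block
because a companion matrix is cyclic. Distinct real roots diagonalize. -/
theorem hasRow_of_semidirect_companion (h : (semidirectBrackets 0 q 1 s).Holds e) (hs : s ≠ 0) :
    HasRow L := by
  rcases lt_trichotomy (s ^ 2 + 4 * q) 0 with hd | hd | hd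
  · have hk := Real.sq_sqrt (by linarith : 0 ≤ -(s ^ 2 + 4 * q))
    have hk0 := Real.sqrt_pos.2 (by linarith : 0 < -(s ^ 2 + 4 * q))
    set k := √(-(s ^ 2 + 4 * q))
    refine ⟨.r3l' (s / k) (div_ne_zero hs hk0.ne'),
      h.exists_of_changesTo (-(s / k)) (2 / k) 0 1 0 0 0 0 (2 / k) ?_ ?_⟩
    · simp [hk0.ne']
    · simp [semidirectBrackets, Brackets.ChangesTo, Row.brackets]
      refine ⟨?_, ?_⟩ <;> field_simp <;> linarith
  · refine ⟨.r3, h.exists_of_changesTo (-1) (2 / s) 0 1 0 0 0 0 (2 / s) ?_ ?_⟩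
    · simp [hs]
    · simp [semidirectBrackets, Brackets.ChangesTo, Row.brackets]
      refine ⟨?_, ?_⟩ <;> field_simp <;> linarith
  · have hk := Real.sq_sqrt hd.le
    have hk0 := Real.sqrt_pos.2 hd
    set k := √(s ^ 2 + 4 * q)
    obtain ⟨f, hf⟩ : ∃ f : Basis (Fin 3) ℝ L,
        (semidirectBrackets ((s + k) / 2) 0 0 ((s - k) / 2)).Holds f := by
      refine h.exists_of_changesTo (-((s - k) / 2)) 1 0 (-((s + k) / 2)) 1 0 0 0 1 ?_ ?_
      · have : k ≠ 0 := hk0.ne'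
        convert this using 1
        ring
      · simp [semidirectBrackets, Brackets.ChangesTo]
        refine ⟨⟨?_, ?_⟩, ?_, ?_⟩ <;> linarith
    exact hasRow_of_semidirect_diagonal hf (by convert hs using 1; ring)

theorem hasRow_of_semidirect_cyclic (h : (semidirectBrackets p q r s).Holds e) (hps : p + s ≠ 0)
    (hr : r ≠ 0) : HasRow L := by
  obtain ⟨f, hf⟩ : ∃ f : Basis (Fin 3) ℝ L,
      (semidirectBrackets 0 (-(p * s - q * r)) 1 (p + s)).Holds f := by
    -- As r ≠ 0, e₁ is a cyclic vector for ad e₃ on ⟨e₁, e₂⟩; the new second vector is [e₃, e₁].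
    refine h.exists_of_changesTo 1 0 0 p r 0 0 0 1 (by simpa using hr) ?_
    simp [semidirectBrackets, Brackets.ChangesTo]
    refine ⟨?_, ?_⟩ <;> ring
  exact hasRow_of_semidirect_companion hf hps

theorem hasRow_of_semidirect (h : (semidirectBrackets p q r s).Holds e) (hps : p + s ≠ 0) :
    HasRow L := by
  by_cases hr : r = 0
  · subst hr
    by_cases hq : q = 0
    · subst hq
      exact hasRow_of_semidirect_diagonal h hps
    · obtain ⟨f, hf⟩ : ∃ f : Basis (Fin 3) ℝ L, (semidirectBrackets s 0 q p).Holds f :=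
        h.exists_of_changesTo 0 1 0 1 0 0 0 0 1 (by simp)
          (by simp [semidirectBrackets, Brackets.ChangesTo])
      exact hasRow_of_semidirect_cyclic hf (by rwa [add_comm]) hq
  · exact hasRow_of_semidirect_cyclic h hps hr

theorem exists_holds (e : Basis (Fin 3) ℝ L) : ∃ s : Brackets, s.Holds e := by
  obtain ⟨a₁, a₂, a₃, ha⟩ := exists_lin e ⁅e 0, e 1⁆
  obtain ⟨b₁, b₂, b₃, hb⟩ := exists_lin e ⁅e 0, e 2⁆
  obtain ⟨c₁, c₂, c₃, hc⟩ := exists_lin e ⁅e 2, e 1⁆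
  exact ⟨⟨a₁, a₂, a₃, b₁, b₂, b₃, c₁, c₂, c₃⟩, ha, hb, hc⟩

theorem trace_ad_lie (x y : L) : LinearMap.trace ℝ L (LieAlgebra.ad ℝ L ⁅x, y⁆) = 0 := by
  have h : LieAlgebra.ad ℝ L ⁅x, y⁆ = LieAlgebra.ad ℝ L x * LieAlgebra.ad ℝ L y -
      LieAlgebra.ad ℝ L y * LieAlgebra.ad ℝ L x := by
    ext z
    simp
  rw [h, map_sub, LinearMap.trace_mul_comm, sub_self]

/-- The functional τ = tr ad vanishes on brackets. Adding multiples of e₃ puts f₁, f₂ in its kernel,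
so no bracket has an f₃ component. Then [f₁, f₂] = a₁f₁ + a₂f₂ with a₂ = τ(f₁) = 0 and a₁ = -τ(f₂) =
0, so the kernel is an abelian ideal. -/
theorem hasRow_of_trace_ne_zero (e : Basis (Fin 3) ℝ L)
    (he : LinearMap.trace ℝ L (LieAlgebra.ad ℝ L (e 2)) ≠ 0) : HasRow L := by
  set τ : L → ℝ := fun x => LinearMap.trace ℝ L (LieAlgebra.ad ℝ L x) with hτ
  have hτl (f : Basis (Fin 3) ℝ L) (a b c : ℝ) :
      τ (lin f a b c) = a * τ (f 0) + b * τ (f 1) + c * τ (f 2) := by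
    simp [hτ, lin]
  have he' : τ (e 2) ≠ 0 := he
  obtain ⟨f, h0, h1, h2⟩ := exists_basis_lin e (u₁ := 1) (u₂ := 0) (u₃ := -τ (e 0) / τ (e 2))
    (v₁ := 0) (v₂ := 1) (v₃ := -τ (e 1) / τ (e 2)) (w₁ := 0) (w₂ := 0) (w₃ := 1) (by simp)
  have t0 : τ (f 0) = 0 := by
    rw [h0, hτl]
    field_simp
    ring
  have t1 : τ (f 1) = 0 := by
    rw [h1, hτl]
    field_simp
    ring
  have t2 : τ (f 2) ≠ 0 := by
    rw [h2, ← basis_two_eq_lin]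
    exact he
  obtain ⟨s, hs⟩ := exists_holds f
  have ha := trace_ad_lie (f 0) (f 1)
  have hb := trace_ad_lie (f 0) (f 2)
  have hc := trace_ad_lie (f 2) (f 1)
  rw [hs.h12] at ha
  rw [hs.h13] at hb
  rw [hs.h32] at hc
  replace ha := (hτl f _ _ _).symm.trans ha
  replace hb := (hτl f _ _ _).symm.trans hb
  replace hc := (hτl f _ _ _).symm.trans hc
  simp only [t0, t1, mul_zero, zero_add, mul_eq_zero, t2, or_false] at ha hb hc
  have r0 := hs.trace_ad_lin 1 0 0
  have r1 := hs.trace_ad_lin 0 1 0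
  have r2 := hs.trace_ad_lin 0 0 1
  rw [← basis_zero_eq_lin] at r0
  rw [← basis_one_eq_lin] at r1
  rw [← basis_two_eq_lin] at r2
  have ha2 : s.a₂ = 0 := by linarith [t0]
  have ha1 : s.a₁ = 0 := by linarith [t1]
  have hs' : semidirectBrackets (-s.b₁) s.c₁ (-s.b₂) s.c₂ = s := by
    cases s
    simp_all [semidirectBrackets]
  rw [← hs'] at hs
  refine hasRow_of_semidirect hs fun h0 => t2 ?_
  change LinearMap.trace ℝ L (LieAlgebra.ad ℝ L (f 2)) = 0
  linarith

end NonUnimodular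

theorem hasRow_of_finrank_eq_three (hL : Module.finrank ℝ L = 3) (hn : ¬ IsLieAbelian L) :
    HasRow L := by
  have : Module.Finite ℝ L := Module.finite_of_finrank_pos (by omega)
  let e : Basis (Fin 3) ℝ L := Module.finBasisOfFinrankEq ℝ L hL
  by_cases h : ∃ i, LinearMap.trace ℝ L (LieAlgebra.ad ℝ L (e i)) ≠ 0
  · obtain ⟨i, hi⟩ := h
    -- The vector with nonzero trace is moved to the last place.
    exact hasRow_of_trace_ne_zero (e.reindex (Equiv.swap i 2)) (by simpa using hi)
  · push Not at h
    obtain ⟨s, hs⟩ := exists_holds e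
    have h0 := h 0
    have h1 := h 1
    have h2 := h 2
    rw [basis_zero_eq_lin, hs.trace_ad_lin] at h0
    rw [basis_one_eq_lin, hs.trace_ad_lin] at h1
    rw [basis_two_eq_lin, hs.trace_ad_lin] at h2
    exact hasRow_of_unimodular hs (by linarith) (by linarith) (by linarith) hn

end

end CoboundaryLie

end

theorem mainTheorem1 :
    -- the table describes Lie algebras, and all nonabelian ones of dimension three
    (∀ t : CoboundaryLie.Row, ∃ (M : Type) (_ : LieRing M) (_ : LieAlgebra ℝ M)
      (e : Module.Basis (Fin 3) ℝ M), t.Relations e) ∧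
    (∀ (L : Type*) [LieRing L] [LieAlgebra ℝ L], Module.finrank ℝ L = 3 → ¬ IsLieAbelian L →
      ∃ (t : CoboundaryLie.Row) (e : Module.Basis (Fin 3) ℝ L), t.Relations e) ∧
    ∀ (L : Type*) [LieRing L] [LieAlgebra ℝ L] (t : CoboundaryLie.Row)
      (e : Module.Basis (Fin 3) ℝ L), t.Relations e →
      -- the invariant bivectors and trivectors
      CoboundaryLie.inv2 e = t.inv2 e ∧
      CoboundaryLie.inv3 e = t.inv3 L ∧
      -- the bracket of a bivector with itself, the mCYBE and the r-matrices
      (∀ x y z : ℝ, CoboundaryLie.schoutenSq e (CoboundaryLie.bivec e x y z) =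
        t.schoutenCoeff x y z • CoboundaryLie.e123 e) ∧
      {r | CoboundaryLie.MCYBE e r} = CoboundaryLie.locus e t.YB ∧
      {r | CoboundaryLie.IsRMatrix e r} = CoboundaryLie.locus e t.YB ∧
      -- cocommutators up to automorphisms are the same as orbits of reduced r-matrices
      (∀ r r', CoboundaryLie.IsRMatrix e r → CoboundaryLie.IsRMatrix e r' →
        (CoboundaryLie.CocommutatorEquiv (CoboundaryLie.cobracket e r)
          (CoboundaryLie.cobracket e r') ↔ CoboundaryLie.ReducedEquiv e r r')) ∧
      -- the classes of nonzero coboundary cocommutators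
      CoboundaryLie.nonzeroClasses e = t.classes e ∧
      -- the representatives
      (∀ r ∈ t.reps e, CoboundaryLie.IsRMatrix e r ∧ CoboundaryLie.cobracket e r ≠ 0) ∧
      (∀ δ, CoboundaryLie.IsCoboundary e δ → δ ≠ 0 →
        ∃! r, r ∈ t.reps e ∧
          CoboundaryLie.CocommutatorEquiv δ (CoboundaryLie.cobracket e r)) := by
  refine ⟨fun t => ?_, fun L _ _ hL hn => ?_, fun L _ _ t e h => ?_⟩
  · exact ⟨t.Model, inferInstance, inferInstance, t.modelBasis,
      (t.relations_iff _).2 t.modelBasis_holds⟩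
  · obtain ⟨t, e, h⟩ := CoboundaryLie.hasRow_of_finrank_eq_three hL hn
    exact ⟨t, e, (t.relations_iff e).2 h⟩
  · rw [t.relations_iff] at h
    exact ⟨t.inv2_eq h, t.inv3_eq h,
      fun x y z => by rw [h.schoutenSq_bivec, t.sqCoeff_brackets],
      CoboundaryLie.setOf_eq_locus e _ _ (t.mcybe_iff h),
      CoboundaryLie.setOf_eq_locus e _ _ (t.isRMatrix_iff h),
      fun r r' _ _ => CoboundaryLie.cocommutatorEquiv_iff e r r',
      (t.classified h).classes_eq, (t.classified h).reps_ne_zero,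
      (t.classified h).existsUnique_rep⟩
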